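/- **Setting.** Let $A\in\mathbb R^{n\times n}$ be symmetric with eigenvalues $\lambda_1\ge\dots\ge\lambda_n$, $\lambda_1>0$, a corresponding orthonormal eigenbasis $u_1,\dots,u_n$, and singular values $\sigma_1\ge\dots\ge\sigma_n$. Let $q\ge1$ and $d\le n$ be integers, $p\in(0,1)$, $\mathbf 1$ the all-ones vector, and $R(v)=\lambda_1^{-1}\,v^TAv/(v^Tv)$ for $v\ne0$. *RandSum*$(A,q,d,p)$ draws $S=[S_1\;S_2]\in\mathbb R^{n\times d}$ with independent entries, those of $S_1\in\mathbb R^{n\times\lceil d/2\rceil}$ being $\mathcal N(0,1)$ and those of $S_2\in\mathbb R^{n\times\lfloor d/2\rfloor}$ being Bernoulli$(p)$ on $\{0,1\}$; it computes $Y=A^qS$, a QR decomposition $Y=QT$ ($Q\in\mathbb R^{n\times d}$ with $Q^TQ=I$, $T$ upper triangular), $B=Q^TAQ$, and returns $\hat u=Qw$, where $w$ is a unit eigenvector of $B$ for its largest eigenvalue. For $C>0$ let $i_0=i_0(A,q,C)$ be the least $j\in\{1,\dots,n\}$ for which there is $\gamma>1/q$ with $\sigma_i/\sigma_1\le C\,i^{-\gamma}$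 for all $i\in\{j,\dots,n\}$, and $i_0=n$ if there is no such $j$. *Assumption 1 (with $\kappa\in(0,1]$):* $\sum_{i=2}^n\lambda_i^{2q+1}\ge\kappa\sum_{i=2}^n|\lambda_i|^{2q+1}$. *Assumption 2 (with $\nu>0$, $\kappa'\in(0,1]$):* $\langle u_1,\mathbf 1\rangle^2\ge\nu$ and $\sum_{i=2}^n\lambda_i^{2q+1}\xi_i\ge\kappa'\sum_{i=2}^n|\lambda_i|^{2q+1}\xi_i$, where $\xi_i=\mathbb E\,\langle M^Tu_i,\mathbf 1_d/\sqrt d\rangle^2$ for an $n\times d$ matrix $M$ with i.i.d. Bernoulli$(p)$ entries. **Theorem.** There are constants $c_\kappa\in(0,1]$ depending only on $\kappa$; $c_{\kappa'}\in(0,1]$ depending only on $\kappa,\kappa',p,\nu$; $b,x_0>0$ depending only on $p,\nu$; and $c>0$ depending only on $p,\nu,C$, such that the following holds. If $A$ satisfies Assumptions 1 and 2 and $\sqrt d\,\min(\kappa,\kappa')^2\ge x_0$, then, except on an event of probability at most $e^{-b\sqrt d\,\min(\kappa,\kappa')^2}$, every output $\hat u$ of RandSum$(A,q,d,p)$ satisfies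 $$R(\hat u)\;\ge\;c\,\max\left\{c_\kappa\Big(\frac{d}{d+i_0}\Big)^{\frac1{2q+1}},\;c_{\kappa'}\Big(\frac{\max\{d,\langle u_1,\mathbf 1\rangle^2\}}{n}\Big)^{\frac1{2q+1}}\right\}.$$ -/

import Mathlib

open MeasureTheory ProbabilityTheory Matrix

noncomputable section

namespace RandSum

/-- `lam 0 ≥ lam 1 ≥ …` are the eigenvalues of `A`, counted with multiplicity, and
`u 0, u 1, …` is a corresponding orthonormal basis of eigenvectors. (Indices start at `0`, so
`lam 0`, `u 0` are the top eigenvalue and the top eigenvector.) -/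
def IsSortedEigensystem {n : ℕ} (A : Matrix (Fin n) (Fin n) ℝ) (lam : Fin n → ℝ)
    (u : OrthonormalBasis (Fin n) ℝ (EuclideanSpace ℝ (Fin n))) : Prop :=
  Antitone lam ∧ ∀ i, A *ᵥ (u i).ofLp = lam i • (u i).ofLp

/-- The inner product of `v` with the all-ones vector. -/
def sumCoord {n : ℕ} (v : EuclideanSpace ℝ (Fin n)) : ℝ := ∑ k, v k

/-- The `i`-th largest singular value, `i = 1, 2, …`. -/
def singularValue {n : ℕ} (A : Matrix (Fin n) (Fin n) ℝ) (i : ℕ) : ℝ :=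
  (Matrix.toEuclideanLin A).singularValues (i - 1)

/-- The indices `j ∈ {1, …, n}` from which on the normalised singular values are bounded by
`C * i ^ (-γ)` for some `γ > 1 / q`. -/
def powerLawSet {n : ℕ} (A : Matrix (Fin n) (Fin n) ℝ) (q : ℕ) (C : ℝ) : Set ℕ :=
  {j | 1 ≤ j ∧ j ≤ n ∧ ∃ γ : ℝ, 1 / (q : ℝ) < γ ∧ ∀ i : ℕ, j ≤ i → i ≤ n →
    singularValue A i / singularValue A 1 ≤ C * (i : ℝ) ^ (-γ)}

open Classical in
/-- The index `i₀`: the least element of `powerLawSet A q C`, or `n` if that set is empty. -/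
def powerLawIndex {n : ℕ} (A : Matrix (Fin n) (Fin n) ℝ) (q : ℕ) (C : ℝ) : ℕ :=
  if (powerLawSet A q C).Nonempty then sInf (powerLawSet A q C) else n

/-- The normalised Rayleigh quotient `R(v) = lam1⁻¹ * (vᵀ A v) / (vᵀ v)`. -/
def rayleigh {n : ℕ} (A : Matrix (Fin n) (Fin n) ℝ) (lam1 : ℝ) (v : Fin n → ℝ) : ℝ :=
  lam1⁻¹ * ((v ⬝ᵥ (A *ᵥ v)) / (v ⬝ᵥ v))

/-- `w` is a unit eigenvector of `B` for the largest eigenvalue of `B`. -/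
def IsTopEigenvector {d : ℕ} (B : Matrix (Fin d) (Fin d) ℝ) (w : Fin d → ℝ) : Prop :=
  w ⬝ᵥ w = 1 ∧ ∃ μ : ℝ, Module.End.HasEigenvector (Matrix.toLin' B) μ w ∧
    ∀ μ' : ℝ, Module.End.HasEigenvalue (Matrix.toLin' B) μ' → μ' ≤ μ

/-- `v` is a possible output of the randomized SVD run on `A` with test matrix `S` and `q`
iterations: `Y = A ^ q * S`, `Y = Q * T` is a QR decomposition, `B = Qᵀ * A * Q`, and `v = Q w`
for a unit top eigenvector `w` of `B`. Any QR decomposition and any `w` may be chosen. -/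
def IsRSVDOutput {n d : ℕ} (A : Matrix (Fin n) (Fin n) ℝ) (S : Matrix (Fin n) (Fin d) ℝ) (q : ℕ)
    (v : Fin n → ℝ) : Prop :=
  ∃ (Q : Matrix (Fin n) (Fin d) ℝ) (T : Matrix (Fin d) (Fin d) ℝ) (w : Fin d → ℝ),
    Qᵀ * Q = 1 ∧ T.BlockTriangular id ∧ A ^ q * S = Q * T ∧
    IsTopEigenvector (Qᵀ * A * Q) w ∧ v = Q *ᵥ w

/-- The law of an `n × d` matrix with i.i.d. Bernoulli(`p`) entries with values in `{0, 1}`. -/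
def bernoulliMatrixLaw (n d : ℕ) (p : unitInterval) : Measure (Fin n → Fin d → ℝ) :=
  Measure.pi fun _ => Measure.pi fun _ => bernoulliMeasure (1 : ℝ) 0 p

/-- The law of the test matrix `S = [S₁ S₂]` of RandSum: all entries are independent, those of the
first `⌈d / 2⌉` columns are standard Gaussian and those of the last `⌊d / 2⌋` columns are
Bernoulli(`p`). -/
def randSumLaw (n d : ℕ) (p : unitInterval) : Measure (Fin n → Fin d → ℝ) :=
  Measure.pi fun _ => Measure.pi fun j : Fin d =>
    if (j : ℕ) < (d + 1) / 2 then gaussianReal 0 1 else bernoulliMeasure (1 : ℝ) 0 p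

/-- The weight `ξ(v) = 𝔼 ⟨Sᵀ v, 1 / √d⟩ ^ 2` for an `n × d` Bernoulli(`p`) matrix `S`. -/
def bernoulliWeight {n : ℕ} (d : ℕ) (p : unitInterval) (v : EuclideanSpace ℝ (Fin n)) : ℝ :=
  ∫ S, (((Matrix.of S)ᵀ *ᵥ v.ofLp) ⬝ᵥ (fun _ : Fin d => 1 / √(d : ℝ))) ^ 2
    ∂(bernoulliMatrixLaw n d p)

/-- The first spectral assumption, with parameter `κ`. -/
def SpectralAssumption {n : ℕ} [NeZero n] (lam : Fin n → ℝ) (q : ℕ) (κ : ℝ) : Prop :=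
  κ * ∑ i ∈ Finset.univ.erase 0, |lam i| ^ (2 * q + 1)
    ≤ ∑ i ∈ Finset.univ.erase 0, lam i ^ (2 * q + 1)

/-- The second spectral assumption, with parameters `ν` and `κ'`. -/
def WeightedSpectralAssumption {n : ℕ} [NeZero n] (lam : Fin n → ℝ)
    (u : OrthonormalBasis (Fin n) ℝ (EuclideanSpace ℝ (Fin n))) (q d : ℕ) (p : unitInterval)
    (ν κ' : ℝ) : Prop :=
  ν ≤ sumCoord (u 0) ^ 2 ∧
  κ' * ∑ i ∈ Finset.univ.erase 0, |lam i| ^ (2 * q + 1) * bernoulliWeight d p (u i)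
    ≤ ∑ i ∈ Finset.univ.erase 0, lam i ^ (2 * q + 1) * bernoulliWeight d p (u i)

end RandSum

end

/-! The output maximises the Rayleigh quotient over the range of `Q`, which contains every `A ^ q S
a`. Hence it reaches the level `τ` as soon as a single `a` makes `∑ f i * ⟨u i, S a⟩ ^ 2` positive,
where `f = shiftedWeight lam q τ` and, with `μ i = lam i / lam 0`, `f i = μ i ^ (2q+1) - τ * μ i ^
(2q)`. A bad output therefore puts the columns in the closed set `uncertified`. Since `a` may be
supported on the Gaussian or on the Bernoulli columns only, each half of the test matrix can be
treated as an i.i.d. family.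

First certificate (`IsEntryLaw.measure_uncertified_le`): let `a` run over the unit vectors and add
up the forms. Each column contributes a quadratic form whose mean, by the spectral assumptions, is
at least a multiple of `κ` times its absolute size. Squares of sub-Gaussian variables have
exponential moments, and Jensen's inequality transfers these to the form, although its coordinates
in the eigenbasis may be dependent. A Chernoff bound then gives failure probability `exp (-const * κ
^ 2 * d)`.

Second certificate (`measure_uncertified_gaussian_le`), for Gaussian columns when `P = ∑ i ≠ 0, |μ
i| ^ (2q+1)` is small compared with their number `m`: by rotation invariance the vector `g` of top
coordinates is independent of the other coordinates. The Gram matrix of the rest, weighted by bounds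
for `|f i|`, has small trace, hence at least `m / 2` small eigenvalues; projecting `g` to their
eigenspace yields an `a` for which the top term wins. This choice of `a` is what puts `d` into the
numerator of `d / (d + i₀)`.

What remains is deterministic: how large `τ` may be while `τ * ∑ μ i ^ (2q)`, suitably weighted,
stays below a multiple of `κ` times the sum of the next powers. Splitting each term at a threshold
`θ` gives `s ^ (2q) ≤ θ ^ (2q) + s ^ (2q+1) / θ`. The first summand is counted with total weight `n
* p` for Bernoulli columns; for Gaussian columns it is counted about `i₀` times, the power law
controlling the tail. Balancing `θ` produces the exponent `1 / (2q+1)`. -/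

open MeasureTheory ProbabilityTheory Matrix

noncomputable section

namespace RandSum

/-! ### Coordinates in an orthonormal basis -/

section Coordinates

variable {n : ℕ} (u : OrthonormalBasis (Fin n) ℝ (EuclideanSpace ℝ (Fin n)))

lemma inner_eq_dotProduct (x : EuclideanSpace ℝ (Fin n)) (y : Fin n → ℝ) :
    inner ℝ x (WithLp.toLp 2 y) = x.ofLp ⬝ᵥ y := by
  simp [PiLp.inner_apply, dotProduct, mul_comm]

lemma sum_dotProduct_mul_dotProduct (x y : Fin n → ℝ) :
    ∑ i, ((u i).ofLp ⬝ᵥ x) * ((u i).ofLp ⬝ᵥ y) = x ⬝ᵥ y := by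
  have h := u.sum_inner_mul_inner (WithLp.toLp 2 x) (WithLp.toLp 2 y)
  rw [inner_eq_dotProduct] at h
  simp only [inner_eq_dotProduct] at h
  rw [← h]
  refine Finset.sum_congr rfl fun i _ => ?_
  rw [real_inner_comm, inner_eq_dotProduct]

lemma dotProduct_self_eq_one (i : Fin n) : (u i).ofLp ⬝ᵥ (u i).ofLp = 1 := by
  have h := u.orthonormal.1 i
  rw [← inner_eq_dotProduct]
  simp [h]

lemma dotProduct_eq_ite (i j : Fin n) :
    (u i).ofLp ⬝ᵥ (u j).ofLp = if i = j then 1 else 0 := by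
  have h := orthonormal_iff_ite.mp u.orthonormal i j
  rw [← inner_eq_dotProduct]
  simpa using h

variable {u} {A : Matrix (Fin n) (Fin n) ℝ} {lam : Fin n → ℝ}

lemma dotProduct_mulVec_of_eigen (hA : A.IsSymm) (hu : ∀ i, A *ᵥ (u i).ofLp = lam i • (u i).ofLp)
    (i : Fin n) (x : Fin n → ℝ) :
    (u i).ofLp ⬝ᵥ (A *ᵥ x) = lam i * ((u i).ofLp ⬝ᵥ x) := by
  rw [dotProduct_mulVec, ← mulVec_transpose, hA.eq, hu, smul_dotProduct, smul_eq_mul]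

lemma dotProduct_pow_mulVec_of_eigen (hA : A.IsSymm)
    (hu : ∀ i, A *ᵥ (u i).ofLp = lam i • (u i).ofLp) (q : ℕ) (i : Fin n) (x : Fin n → ℝ) :
    (u i).ofLp ⬝ᵥ (A ^ q *ᵥ x) = lam i ^ q * ((u i).ofLp ⬝ᵥ x) := by
  induction q with
  | zero => simp
  | succ k ih =>
    rw [pow_succ', ← mulVec_mulVec, dotProduct_mulVec_of_eigen hA hu, ih]
    ring

lemma quadForm_eq_sum (hA : A.IsSymm) (hu : ∀ i, A *ᵥ (u i).ofLp = lam i • (u i).ofLp)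
    (x : Fin n → ℝ) : x ⬝ᵥ (A *ᵥ x) = ∑ i, lam i * ((u i).ofLp ⬝ᵥ x) ^ 2 := by
  rw [← sum_dotProduct_mul_dotProduct u]
  refine Finset.sum_congr rfl fun i _ => ?_
  rw [dotProduct_mulVec_of_eigen hA hu]
  ring

end Coordinates

/-! ### The top eigenvector maximises the Rayleigh quotient -/

/-- Expand `b` in an orthonormal eigenbasis of `B`; each eigenvalue there is at most the one of `w`.
-/
lemma IsTopEigenvector.quadForm_le {d : ℕ} {B : Matrix (Fin d) (Fin d) ℝ} {w : Fin d → ℝ}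
    (hw : IsTopEigenvector B w) (hB : B.IsSymm) (b : Fin d → ℝ) :
    b ⬝ᵥ (B *ᵥ b) ≤ (w ⬝ᵥ (B *ᵥ w)) * (b ⬝ᵥ b) := by
  obtain ⟨hw1, μ, hμ, hmax⟩ := hw
  have hBw : B *ᵥ w = μ • w := by simpa using hμ.apply_eq_smul
  have hH : B.IsHermitian := by
    rw [Matrix.IsHermitian, conjTranspose_eq_transpose_of_trivial]; exact hB
  have hu := hH.mulVec_eigenvectorBasis
  rw [hBw, dotProduct_smul, hw1, quadForm_eq_sum (u := hH.eigenvectorBasis) hB hu,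
    ← sum_dotProduct_mul_dotProduct hH.eigenvectorBasis b b, Finset.mul_sum]
  refine Finset.sum_le_sum fun i _ => ?_
  have hle : hH.eigenvalues i ≤ μ := by
    refine hmax _ (Module.End.hasEigenvalue_of_hasEigenvector (x := (hH.eigenvectorBasis i).ofLp) ?_)
    refine ⟨?_, ?_⟩
    · rw [Module.End.mem_eigenspace_iff]; simpa using hu i
    · intro h0
      have := dotProduct_self_eq_one hH.eigenvectorBasis i
      simp [h0] at this
  simp only [smul_eq_mul, mul_one]
  nlinarith [sq_nonneg ((hH.eigenvectorBasis i).ofLp ⬝ᵥ b)]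

/-- The weights of `A ^ (2q+1) - τ lam₀ A ^ (2q)`, divided by `lam₀ ^ (2q+1)`. -/
def shiftedWeight {n : ℕ} [NeZero n] (lam : Fin n → ℝ) (q : ℕ) (τ : ℝ) (i : Fin n) : ℝ :=
  (lam i / lam 0) ^ (2 * q + 1) - τ * (lam i / lam 0) ^ (2 * q)

lemma IsRSVDOutput.le_rayleigh {n d q : ℕ} [NeZero n] {A : Matrix (Fin n) (Fin n) ℝ}
    {lam : Fin n → ℝ} {u : OrthonormalBasis (Fin n) ℝ (EuclideanSpace ℝ (Fin n))}
    (hA : A.IsSymm) (hu : IsSortedEigensystem A lam u) (h0 : 0 < lam 0)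
    {S : Matrix (Fin n) (Fin d) ℝ} {v : Fin n → ℝ} (hv : IsRSVDOutput A S q v)
    {τ : ℝ} {a : Fin d → ℝ}
    (ha : 0 < ∑ i, shiftedWeight lam q τ i * ((u i).ofLp ⬝ᵥ (S *ᵥ a)) ^ 2) :
    τ ≤ rayleigh A (lam 0) v := by
  obtain ⟨Q, T, w, hQ, -, hY, hw, rfl⟩ := hv
  have hB : (Qᵀ * A * Q).IsSymm := by
    rw [Matrix.IsSymm, transpose_mul, transpose_mul, transpose_transpose, hA.eq, Matrix.mul_assoc]
  have hquad (b : Fin d → ℝ) :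
      b ⬝ᵥ ((Qᵀ * A * Q) *ᵥ b) = (Q *ᵥ b) ⬝ᵥ (A *ᵥ (Q *ᵥ b)) := by
    rw [← mulVec_mulVec, ← mulVec_mulVec, dotProduct_mulVec, vecMul_transpose]
  have hnorm (b : Fin d → ℝ) : b ⬝ᵥ b = (Q *ᵥ b) ⬝ᵥ (Q *ᵥ b) := by
    rw [dotProduct_mulVec, ← mulVec_transpose, mulVec_mulVec, hQ, one_mulVec]
  -- Since `A ^ q * S = Q * T`, the vector `T a` is the coordinate vector of `A ^ q S a` in the
  -- range of `Q`.
  have hle := hw.quadForm_le hB (T *ᵥ a)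
  rw [hquad, hquad, hnorm, mulVec_mulVec, ← hY, ← mulVec_mulVec,
    quadForm_eq_sum hA hu.2, ← sum_dotProduct_mul_dotProduct u (A ^ q *ᵥ (S *ᵥ a))] at hle
  simp only [dotProduct_pow_mulVec_of_eigen hA hu.2] at hle
  have hray : rayleigh A (lam 0) (Q *ᵥ w) =
      (lam 0)⁻¹ * ((Q *ᵥ w) ⬝ᵥ (A *ᵥ (Q *ᵥ w))) := by
    rw [rayleigh, ← hnorm, hw.1, div_one]
  rw [hray]
  set μ := (Q *ᵥ w) ⬝ᵥ (A *ᵥ (Q *ᵥ w))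
  by_contra! hlt
  have hμ : μ ≤ τ * lam 0 := by
    rw [inv_mul_lt_iff₀ h0] at hlt; linarith
  have hscale : lam 0 ^ (2 * q + 1) *
      ∑ i, shiftedWeight lam q τ i * ((u i).ofLp ⬝ᵥ (S *ᵥ a)) ^ 2 =
      ∑ i, lam i * (lam i ^ q * ((u i).ofLp ⬝ᵥ (S *ᵥ a))) ^ 2 -
        (τ * lam 0) * ∑ i, (lam i ^ q * ((u i).ofLp ⬝ᵥ (S *ᵥ a))) *
          (lam i ^ q * ((u i).ofLp ⬝ᵥ (S *ᵥ a))) := by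
    rw [Finset.mul_sum, Finset.mul_sum, ← Finset.sum_sub_distrib]
    refine Finset.sum_congr rfl fun i _ => ?_
    rw [shiftedWeight, div_pow, div_pow]
    field_simp
    ring
  have hpos := mul_pos (pow_pos h0 (2 * q + 1)) ha
  rw [hscale] at hpos
  have hnn : 0 ≤ ∑ i, (lam i ^ q * ((u i).ofLp ⬝ᵥ (S *ᵥ a))) *
      (lam i ^ q * ((u i).ofLp ⬝ᵥ (S *ᵥ a))) := Finset.sum_nonneg fun i _ => mul_self_nonneg _
  nlinarith

/-- The families of columns of which no linear combination certifies that the Rayleigh quotient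
of the output is large. -/
def uncertified {n : ℕ} (ι : Type*) [Fintype ι] (f : Fin n → ℝ)
    (u : OrthonormalBasis (Fin n) ℝ (EuclideanSpace ℝ (Fin n))) : Set (ι → Fin n → ℝ) :=
  {Y | ∀ a : ι → ℝ, ∑ i, f i * (∑ j, a j * ((u i).ofLp ⬝ᵥ Y j)) ^ 2 ≤ 0}

/-- Closedness gives measurability: the event of the theorem is only bounded from above, through
this measurable superset. -/
lemma isClosed_uncertified {n : ℕ} (ι : Type*) [Fintype ι] (f : Fin n → ℝ)
    (u : OrthonormalBasis (Fin n) ℝ (EuclideanSpace ℝ (Fin n))) :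
    IsClosed (uncertified ι f u) := by
  simp only [uncertified, Set.ofPred_forall]
  refine isClosed_iInter fun a => isClosed_le ?_ continuous_const
  simp only [dotProduct]
  fun_prop

/-- Coefficients on the selected columns extend by zero to all columns. This is what allows the
Gaussian or the Bernoulli half to be discarded. -/
lemma restrict_mem_uncertified {n : ℕ} {ι : Type*} [Fintype ι] {f : Fin n → ℝ}
    {u : OrthonormalBasis (Fin n) ℝ (EuclideanSpace ℝ (Fin n))} {Y : ι → Fin n → ℝ}
    (hY : Y ∈ uncertified ι f u) (P : ι → Prop) [DecidablePred P] :
    (fun j : {j // P j} => Y j) ∈ uncertified {j // P j} f u := by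
  intro a
  have h := hY fun j => if h : P j then a ⟨j, h⟩ else 0
  have hsum (i : Fin n) : ∑ j, (if h : P j then a ⟨j, h⟩ else 0) * ((u i).ofLp ⬝ᵥ Y j) =
      ∑ j : {j // P j}, a j * ((u i).ofLp ⬝ᵥ Y j) := by
    rw [← Fintype.sum_subtype_add_sum_subtype P, Finset.sum_eq_zero (s := (Finset.univ :
      Finset {j // ¬ P j})) (fun j _ => by rw [dif_neg j.2, zero_mul]), add_zero]
    exact Finset.sum_congr rfl fun j _ => by rw [dif_pos j.2]
  simpa only [hsum] using h

lemma IsRSVDOutput.mem_uncertified {n d q : ℕ} [NeZero n] {A : Matrix (Fin n) (Fin n) ℝ}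
    {lam : Fin n → ℝ} {u : OrthonormalBasis (Fin n) ℝ (EuclideanSpace ℝ (Fin n))}
    (hA : A.IsSymm) (hu : IsSortedEigensystem A lam u) (h0 : 0 < lam 0)
    {S : Fin n → Fin d → ℝ} {v : Fin n → ℝ} (hv : IsRSVDOutput A (Matrix.of S) q v)
    {τ : ℝ} (hlt : rayleigh A (lam 0) v < τ) :
    Function.swap S ∈ uncertified (Fin d) (shiftedWeight lam q τ) u := by
  intro a
  by_contra! hpos
  have hcoord (i : Fin n) : (u i).ofLp ⬝ᵥ (Matrix.of S *ᵥ a) =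
      ∑ j, a j * ((u i).ofLp ⬝ᵥ Function.swap S j) := by
    simp only [dotProduct, mulVec, Matrix.of_apply, Function.swap, Finset.mul_sum]
    rw [Finset.sum_comm]
    exact Finset.sum_congr rfl fun j _ => Finset.sum_congr rfl fun k _ => by ring
  refine absurd (hv.le_rayleigh hA hu h0 (τ := τ) (a := a) ?_) (not_le.mpr hlt)
  simpa only [hcoord] using hpos

/-! ### Singular values of a symmetric matrix -/

section SingularValues

variable {n : ℕ} {A : Matrix (Fin n) (Fin n) ℝ} {lam : Fin n → ℝ}
  {u : OrthonormalBasis (Fin n) ℝ (EuclideanSpace ℝ (Fin n))}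

lemma toEuclideanLin_adjoint_comp_self (hA : A.IsSymm) :
    (toEuclideanLin A).adjoint ∘ₗ toEuclideanLin A = toEuclideanLin A ∘ₗ toEuclideanLin A := by
  rw [← toEuclideanLin_conjTranspose_eq_adjoint, conjTranspose_eq_transpose_of_trivial, hA.eq]

/-- In the basis `u` the operator `AᵀA` is diagonal with entries `lam i ^ 2`, so its characteristic
polynomial determines the squared singular values as a multiset. Only symmetric sums are needed
later, so the `|lam i|` never have to be sorted. -/
lemma map_singularValue_eq (hA : A.IsSymm) (hu : ∀ i, A *ᵥ (u i).ofLp = lam i • (u i).ofLp) :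
    Multiset.map (fun i : Fin n => singularValue A (i + 1)) Finset.univ.val =
      Multiset.map (fun i => |lam i|) Finset.univ.val := by
  classical
  have hfin : Module.finrank ℝ (EuclideanSpace ℝ (Fin n)) = n := by simp
  have hTu (i : Fin n) : toEuclideanLin A (u i) = lam i • u i := by
    rw [toLpLin_apply, hu]; rfl
  have hmat : LinearMap.toMatrix u.toBasis u.toBasis
      ((toEuclideanLin A).adjoint ∘ₗ toEuclideanLin A) = diagonal fun i => lam i ^ 2 := by
    rw [toEuclideanLin_adjoint_comp_self hA]
    ext i j
    rw [LinearMap.toMatrix_apply, LinearMap.comp_apply, u.coe_toBasis, hTu, map_smul, hTu,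
      ← u.coe_toBasis, map_smul, map_smul, Module.Basis.repr_self, diagonal_apply]
    by_cases h : i = j
    · subst h; simp [sq]
    · simp [h]
  have hroots : ((toEuclideanLin A).adjoint ∘ₗ toEuclideanLin A).charpoly.roots =
      Multiset.map (fun i => lam i ^ 2) Finset.univ.val := by
    rw [← LinearMap.charpoly_toMatrix _ u.toBasis, hmat, charpoly_diagonal,
      Polynomial.roots_prod _ _ (Finset.prod_ne_zero_iff.mpr fun i _ =>
        Polynomial.X_sub_C_ne_zero _)]
    simp only [Polynomial.roots_X_sub_C, Multiset.bind_singleton]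
  rw [(toEuclideanLin A).isSymmetric_adjoint_comp_self.roots_charpoly_eq_eigenvalues hfin]
    at hroots
  have h2 := congrArg (Multiset.map Real.sqrt) hroots
  simp only [Multiset.map_map] at h2
  convert h2 using 2
  · simp only [singularValue, Nat.add_sub_cancel, Function.comp]
    exact (toEuclideanLin A).singularValues_fin hfin _
  · simp [Real.sqrt_sq_eq_abs]

lemma sum_comp_singularValue (hA : A.IsSymm) (hu : ∀ i, A *ᵥ (u i).ofLp = lam i • (u i).ofLp)
    (h : ℝ → ℝ) : ∑ i : Fin n, h (singularValue A (i + 1)) = ∑ i, h |lam i| := by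
  have := congrArg (fun s => (Multiset.map h s).sum) (map_singularValue_eq hA hu)
  simp only [Multiset.map_map] at this
  exact this

lemma singularValue_nonneg (i : ℕ) : 0 ≤ singularValue A i :=
  LinearMap.singularValues_nonneg _ _

lemma singularValue_le_singularValue_one (i : ℕ) : singularValue A i ≤ singularValue A 1 :=
  LinearMap.singularValues_antitone _ (by omega)

lemma abs_le_singularValue_one (hA : A.IsSymm)
    (hu : ∀ i, A *ᵥ (u i).ofLp = lam i • (u i).ofLp) (i : Fin n) :
    |lam i| ≤ singularValue A 1 := by
  have hmem : |lam i| ∈ Multiset.map (fun i => |lam i|) (Finset.univ : Finset (Fin n)).val :=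
    Multiset.mem_map_of_mem _ (Finset.mem_univ i)
  rw [← map_singularValue_eq hA hu] at hmem
  obtain ⟨j, -, hj⟩ := Multiset.mem_map.mp hmem
  exact hj ▸ singularValue_le_singularValue_one _

lemma powerLawIndex_spec (q : ℕ) (C : ℝ) : ∃ γ : ℝ, 1 / (q : ℝ) < γ ∧
    ∀ i : ℕ, powerLawIndex A q C < i → i ≤ n →
      singularValue A i / singularValue A 1 ≤ C * (i : ℝ) ^ (-γ) := by
  rw [powerLawIndex]
  split_ifs with h
  · obtain ⟨-, -, γ, hγ, hi⟩ := Nat.sInf_mem h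
    exact ⟨γ, hγ, fun i h1 h2 => hi i h1.le h2⟩
  -- Here the index equals `n`, so no `i` satisfies the range condition and any admissible exponent
  -- serves.
  · exact ⟨1 / (q : ℝ) + 1, by linarith, fun i h1 h2 => by omega⟩

lemma powerLawIndex_le (q : ℕ) (C : ℝ) : powerLawIndex A q C ≤ n := by
  rw [powerLawIndex]
  split_ifs with h
  · exact (Nat.sInf_mem h).2.1
  · exact le_rfl

end SingularValues

/-! ### Comparing consecutive power sums -/

lemma pow_le_pow_add_pow_div {s θ : ℝ} (hs : 0 ≤ s) (hθ : 0 < θ) (k : ℕ) :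
    s ^ k ≤ θ ^ k + s ^ (k + 1) / θ := by
  rcases le_total s θ with h | h
  · have h1 : s ^ k ≤ θ ^ k := pow_le_pow_left₀ hs h k
    have h2 : 0 ≤ s ^ (k + 1) / θ := by positivity
    linarith
  · have h1 : s ^ k ≤ s ^ (k + 1) / θ := by
      rw [le_div_iff₀ hθ, pow_succ]
      exact mul_le_mul_of_nonneg_left h (by positivity)
    have h2 : 0 ≤ θ ^ k := by positivity
    linarith

lemma rpow_root_pow {x : ℝ} (hx : 0 ≤ x) (q : ℕ) :
    (x ^ (1 / (2 * (q : ℝ) + 1))) ^ (2 * q + 1) = x := by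
  rw [← Real.rpow_natCast, ← Real.rpow_mul hx]
  push_cast
  rw [one_div_mul_cancel (by positivity), Real.rpow_one]

lemma rpow_neg_pow_le {q i : ℕ} (hq : 1 ≤ q) {γ : ℝ} (hγ : 1 / (q : ℝ) < γ) (hi : 1 ≤ i) :
    ((i : ℝ) ^ (-γ)) ^ (2 * q) ≤ ((i : ℝ) ^ 2)⁻¹ := by
  have hi' : (1 : ℝ) ≤ i := by exact_mod_cast hi
  have hq' : (0 : ℝ) < q := by exact_mod_cast hq
  rw [← Real.rpow_natCast, ← Real.rpow_mul (by positivity), ← Real.rpow_natCast (i : ℝ) 2,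
    ← Real.rpow_neg (by positivity)]
  refine Real.rpow_le_rpow_of_exponent_le hi' ?_
  rw [div_lt_iff₀ hq'] at hγ
  push_cast
  nlinarith

/-- Indices up to `K` are split at the threshold `θ`. Beyond `K` the power law gives terms at most
`s₀ ^ (2q) * C ^ (2q) / i ^ 2`, because `γ * q > 1`. Cutting at `k + C ^ (2q)` instead of `k` lets
the tail sum `2 / K` of the inverse squares absorb the factor `C ^ (2q)`. The scale `s₀` may exceed
`1`, as the largest singular value may come from a negative eigenvalue. -/
lemma sum_pow_le_of_tail {n q k : ℕ} (hq : 1 ≤ q) {s : Fin n → ℝ} {s₀ C X θ K : ℝ}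
    (hs : ∀ i, 0 ≤ s i) (h1 : 1 ≤ s₀) (hs₀X : s₀ ^ (2 * q + 1) ≤ X)
    (hX : ∑ i, s i ^ (2 * q + 1) ≤ X) (hC : 1 ≤ C) (hθ : 0 < θ) (hK : K = k + C ^ (2 * q))
    {γ : ℝ} (hγ : 1 / (q : ℝ) < γ)
    (htail : ∀ i : Fin n, k < (i : ℕ) + 1 → s i ≤ s₀ * (C * ((i + 1 : ℕ) : ℝ) ^ (-γ))) :
    ∑ i, s i ^ (2 * q) ≤ K * θ ^ (2 * q) + X / θ + 2 * X := by
  have hCq : 1 ≤ C ^ (2 * q) := one_le_pow₀ hC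
  have hK0 : 0 < K := by rw [hK]; positivity
  have hpt (i : Fin n) : s i ^ (2 * q) ≤
      (if (i : ℕ) + 1 ≤ ⌊K⌋₊ then θ ^ (2 * q) else 0) + s i ^ (2 * q + 1) / θ +
      (if ⌊K⌋₊ < (i : ℕ) + 1 then s₀ ^ (2 * q) * C ^ (2 * q) * (((i + 1 : ℕ) : ℝ) ^ 2)⁻¹
        else 0) := by
    by_cases h : (i : ℕ) + 1 ≤ ⌊K⌋₊
    · rw [if_pos h, if_neg (by omega), add_zero]
      exact pow_le_pow_add_pow_div (hs i) hθ _
    · rw [if_neg h, if_pos (by omega), zero_add]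
      have hlt : K < ((i + 1 : ℕ) : ℝ) := (Nat.floor_lt hK0.le).mp (by omega)
      have hk : k < (i : ℕ) + 1 := by
        have : (k : ℝ) < ((i + 1 : ℕ) : ℝ) := by rw [hK] at hlt; linarith
        exact_mod_cast this
      have h2 : s i ^ (2 * q) ≤ s₀ ^ (2 * q) * C ^ (2 * q) * (((i + 1 : ℕ) : ℝ) ^ 2)⁻¹ := by
        refine (pow_le_pow_left₀ (hs i) (htail i hk) _).trans ?_
        rw [mul_pow, mul_pow, mul_assoc]
        have := rpow_neg_pow_le hq hγ (i := i + 1) (by omega)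
        gcongr
      have h3 : 0 ≤ s i ^ (2 * q + 1) / θ := div_nonneg (pow_nonneg (hs i) _) hθ.le
      linarith
  refine (Finset.sum_le_sum fun i _ => hpt i).trans ?_
  rw [Finset.sum_add_distrib, Finset.sum_add_distrib]
  have hA : ∑ i : Fin n, (if (i : ℕ) + 1 ≤ ⌊K⌋₊ then θ ^ (2 * q) else 0) ≤ K * θ ^ (2 * q) := by
    rw [← Finset.sum_filter, Finset.sum_const, nsmul_eq_mul]
    gcongr
    refine le_trans ?_ (Nat.floor_le hK0.le)
    have : (Finset.univ.filter fun i : Fin n => (i : ℕ) + 1 ≤ ⌊K⌋₊).card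
        ≤ (Finset.range ⌊K⌋₊).card :=
      Finset.card_le_card_of_injOn (fun i => (i : ℕ)) (fun i hi => by simp at hi ⊢; omega)
        (fun i _ j _ h => Fin.ext h)
    rw [Finset.card_range] at this
    exact_mod_cast this
  have hB : ∑ i, s i ^ (2 * q + 1) / θ ≤ X / θ := by
    rw [← Finset.sum_div]; gcongr
  have hD : ∑ i : Fin n, (if ⌊K⌋₊ < (i : ℕ) + 1 then
      s₀ ^ (2 * q) * C ^ (2 * q) * (((i + 1 : ℕ) : ℝ) ^ 2)⁻¹ else 0) ≤ 2 * X := by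
    have hsum : ∑ i : Fin n, (if ⌊K⌋₊ < (i : ℕ) + 1 then (((i + 1 : ℕ) : ℝ) ^ 2)⁻¹ else 0) ≤
        2 / (⌊K⌋₊ + 1) := by
      rw [Fin.sum_univ_eq_sum_range
        (fun i => if ⌊K⌋₊ < i + 1 then (((i + 1 : ℕ) : ℝ) ^ 2)⁻¹ else 0) n, ← Finset.sum_filter]
      refine le_trans (le_of_eq ?_) (sum_Ioo_inv_sq_le ⌊K⌋₊ (n + 1))
      refine Finset.sum_bij (fun i _ => i + 1) (fun i hi => ?_) (fun i _ j _ h => by omega)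
        (fun j hj => ?_) (fun i _ => rfl)
      · simp at hi ⊢; omega
      · simp at hj
        exact ⟨j - 1, by simp; omega, by omega⟩
    have hfac : C ^ (2 * q) * (2 / (⌊K⌋₊ + 1)) ≤ 2 := by
      have := Nat.lt_floor_add_one K
      rw [mul_div_assoc', div_le_iff₀ (by positivity)]
      have : C ^ (2 * q) ≤ K := by rw [hK]; linarith [(Nat.cast_nonneg k : (0 : ℝ) ≤ k)]
      linarith
    have hs2 : s₀ ^ (2 * q) ≤ X := (pow_le_pow_right₀ h1 (Nat.le_succ _)).trans hs₀X
    have h0 : 0 ≤ s₀ ^ (2 * q) := by positivity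
    calc _ = s₀ ^ (2 * q) * (C ^ (2 * q) *
          ∑ i : Fin n, (if ⌊K⌋₊ < (i : ℕ) + 1 then (((i + 1 : ℕ) : ℝ) ^ 2)⁻¹ else 0)) := by
          rw [Finset.mul_sum, Finset.mul_sum]
          exact Finset.sum_congr rfl fun i _ => by split_ifs <;> ring
      _ ≤ s₀ ^ (2 * q) * 2 := by
          gcongr
          exact (mul_le_mul_of_nonneg_left hsum (by positivity)).trans hfac
      _ ≤ 2 * X := by linarith
  linarith

lemma mul_sum_pow_le_of_powerLawIndex {n q d : ℕ} [NeZero n] {A : Matrix (Fin n) (Fin n) ℝ}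
    {lam : Fin n → ℝ} {u : OrthonormalBasis (Fin n) ℝ (EuclideanSpace ℝ (Fin n))}
    (hA : A.IsSymm) (hu : IsSortedEigensystem A lam u) (h0 : 0 < lam 0) (hq : 1 ≤ q)
    (hd : 1 ≤ d) (C : ℝ) {β X : ℝ} (hβ : 0 < β) (hdX : (d : ℝ) / 2 ≤ X)
    (hX : ∑ i, |lam i / lam 0| ^ (2 * q + 1) ≤ X) :
    β / (24 * max C 1) * ((d : ℝ) / (d + powerLawIndex A q C)) ^ (1 / (2 * (q : ℝ) + 1)) *
      ∑ i, (lam i / lam 0) ^ (2 * q) ≤ β * X := by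
  set C' := max C 1
  set k := powerLawIndex A q C
  have hC' : 1 ≤ C' := le_max_right _ _
  have hd' : (1 : ℝ) ≤ d := by exact_mod_cast hd
  have hk0 : (0 : ℝ) ≤ k := Nat.cast_nonneg k
  set x : ℝ := (d : ℝ) / (d + k) with hx
  have hx0 : 0 < x := by positivity
  have hx1 : x ≤ 1 := by rw [hx, div_le_one (by positivity)]; linarith
  set r : ℝ := x ^ (1 / (2 * (q : ℝ) + 1)) with hr
  have hr0 : 0 < r := Real.rpow_pos_of_pos hx0 _
  have hr1 : r ≤ 1 := Real.rpow_le_one hx0.le hx1 (by positivity)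
  have hrp : r ^ (2 * q + 1) = x := rpow_root_pow hx0.le q
  -- The power `θ ^ (2q+1)` is `d / (d + k)` divided by `(6 * C') ^ (2q+1)`, so that `(k + C' ^
  -- (2q)) * θ ^ (2q+1)` stays below `d / 2`.
  set θ : ℝ := r / (6 * C') with hθ
  have hθ0 : 0 < θ := by positivity
  have hσ1 : lam 0 ≤ singularValue A 1 :=
    (le_abs_self _).trans (abs_le_singularValue_one hA hu.2 0)
  set s : Fin n → ℝ := fun i => singularValue A (i + 1) / lam 0
  set s₀ : ℝ := singularValue A 1 / lam 0
  have hs (i) : 0 ≤ s i := div_nonneg (singularValue_nonneg _) h0.le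
  have h1 : 1 ≤ s₀ := (one_le_div h0).mpr hσ1
  have hsum (m : ℕ) : ∑ i, s i ^ m = ∑ i, |lam i / lam 0| ^ m := by
    simp only [s, abs_div, abs_of_pos h0]
    exact sum_comp_singularValue hA hu.2 fun y => (y / lam 0) ^ m
  have hX' : ∑ i, s i ^ (2 * q + 1) ≤ X := (hsum _).trans_le hX
  have hs₀X : s₀ ^ (2 * q + 1) ≤ X := by
    refine le_trans ?_ hX'
    have : s₀ = s 0 := by simp [s, s₀]
    rw [this]
    exact Finset.single_le_sum (f := fun i => s i ^ (2 * q + 1))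
      (fun i _ => pow_nonneg (hs i) _) (Finset.mem_univ 0)
  obtain ⟨γ, hγ, htail⟩ := powerLawIndex_spec (A := A) q C
  have hmain := sum_pow_le_of_tail (k := k) hq hs h1 hs₀X hX' hC' hθ0 rfl hγ
    (fun i hi => by
      have h := htail (i + 1) hi i.isLt
      have hσ : 0 < singularValue A 1 := h0.trans_le hσ1
      rw [div_le_iff₀ hσ] at h
      have h2 : C * ((i + 1 : ℕ) : ℝ) ^ (-γ) ≤ C' * ((i + 1 : ℕ) : ℝ) ^ (-γ) := by
        gcongr; exact le_max_left _ _
      have h3 : singularValue A (i + 1) ≤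
          C' * ((i + 1 : ℕ) : ℝ) ^ (-γ) * singularValue A 1 :=
        h.trans (mul_le_mul_of_nonneg_right h2 hσ.le)
      calc s i ≤ C' * ((i + 1 : ℕ) : ℝ) ^ (-γ) * singularValue A 1 / lam 0 := by
            simp only [s]; gcongr
        _ = _ := by simp only [s₀]; ring)
  have habs : ∑ i, (lam i / lam 0) ^ (2 * q) = ∑ i, s i ^ (2 * q) := by
    rw [hsum]
    refine Finset.sum_congr rfl fun i _ => ?_
    rw [pow_mul, pow_mul, sq_abs]
  have hKθ : (k + C' ^ (2 * q)) * θ ^ (2 * q + 1) ≤ X := by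
    rw [hθ, div_pow, hrp, hx]
    have hCq : 1 ≤ C' ^ (2 * q) := one_le_pow₀ hC'
    have h6 : 6 * C' ^ (2 * q) ≤ (6 * C') ^ (2 * q + 1) := by
      rw [mul_pow, pow_succ C']
      have : (6 : ℝ) ≤ 6 ^ (2 * q + 1) := le_self_pow₀ (by norm_num) (by omega)
      have h' : C' ^ (2 * q) ≤ C' ^ (2 * q) * C' := le_mul_of_one_le_right (by positivity) hC'
      gcongr
    have hk2 : k + C' ^ (2 * q) ≤ (d + k) * C' ^ (2 * q) := by nlinarith
    refine le_trans ?_ hdX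
    rw [mul_div_assoc', div_le_div_iff₀ (by positivity) (by norm_num)]
    have e1 : (k + C' ^ (2 * q)) * (d / (d + k)) ≤ d * C' ^ (2 * q) := by
      rw [mul_div_assoc', div_le_iff₀ (by positivity)]
      nlinarith
    nlinarith
  have hτ : β / (24 * C') * r = β * θ / 4 := by rw [hθ]; field_simp; ring
  have hX0 : 0 < X := by linarith
  have hθ6 : θ ≤ 1 / 6 := by
    rw [hθ, div_le_div_iff₀ (by positivity) (by norm_num)]; linarith
  rw [hτ, habs]
  calc β * θ / 4 * ∑ i, s i ^ (2 * q)
      ≤ β * θ / 4 * ((k + C' ^ (2 * q)) * θ ^ (2 * q) + X / θ + 2 * X) := by gcongr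
    _ = β / 4 * ((k + C' ^ (2 * q)) * θ ^ (2 * q + 1) + X + 2 * θ * X) := by
        field_simp; ring
    _ ≤ β / 4 * (X + X + 2 * X) := by
        gcongr
        linarith
    _ = β * X := by ring

/-! ### Product measures -/

lemma measurePreserving_swap_pi {n d : ℕ} (ν : Fin d → Measure ℝ)
    [∀ j, IsProbabilityMeasure (ν j)] :
    MeasurePreserving (Function.swap : (Fin n → Fin d → ℝ) → Fin d → Fin n → ℝ)
      (Measure.pi fun _ => Measure.pi ν) (Measure.pi fun j => Measure.pi fun _ => ν j) := by
  have hmeas : Measurable (Function.swap : (Fin n → Fin d → ℝ) → Fin d → Fin n → ℝ) := by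
    unfold Function.swap; fun_prop
  refine ⟨hmeas, Eq.symm ?_⟩
  refine Measure.pi_eq_generateFrom (fun _ => generateFrom_pi) (fun _ => isPiSystem_pi)
    (fun j => Measure.FiniteSpanningSetsIn.pi fun _ => (ν j).toFiniteSpanningSetsIn) ?_
  intro s hs
  choose t ht hts using hs
  have ht' : ∀ j i, MeasurableSet (t j i) := fun j i => ht j i (Set.mem_univ i)
  have hpre : (Function.swap : (Fin n → Fin d → ℝ) → Fin d → Fin n → ℝ) ⁻¹' (Set.univ.pi s) =
      Set.univ.pi fun i => Set.univ.pi fun j => t j i := by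
    ext S
    simp only [Set.mem_preimage, Set.mem_univ_pi, ← hts, Function.swap]
    exact forall_comm
  rw [Measure.map_apply hmeas (MeasurableSet.univ_pi fun j => by
    rw [← hts]; exact MeasurableSet.univ_pi (ht' j)), hpre, Measure.pi_pi]
  simp only [Measure.pi_pi, ← hts]
  exact Finset.prod_comm

lemma measurePreserving_subtype_restrict {ι : Type*} [Fintype ι] {E : Type*} [MeasurableSpace E]
    (ρ : ι → Measure E) [∀ j, IsProbabilityMeasure (ρ j)] (P : ι → Prop) [DecidablePred P] :
    MeasurePreserving (fun (Y : ι → E) (j : {j // P j}) => Y j)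
      (Measure.pi ρ) (Measure.pi fun j : {j // P j} => ρ j) :=
  measurePreserving_fst.comp (measurePreserving_piEquivPiSubtypeProd ρ P)

/-- Replacing one coordinate of a product measure by an independent copy. -/
lemma measurePreserving_update_pi {ι : Type*} [Fintype ι] [DecidableEq ι] {E : Type*}
    [MeasurableSpace E] (ν : Measure E) [IsProbabilityMeasure ν] (i : ι) :
    MeasurePreserving (fun z : (ι → E) × E => Function.update z.1 i z.2)
      ((Measure.pi fun _ => ν).prod ν) (Measure.pi fun _ => ν) := by
  have hmeas : Measurable (fun z : (ι → E) × E => Function.update z.1 i z.2) := by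
    refine measurable_pi_lambda _ fun k => ?_
    by_cases h : k = i
    · subst h; simpa using measurable_snd
    · simp only [Function.update_of_ne h]; fun_prop
  refine ⟨hmeas, (Measure.pi_eq fun s hs => ?_).symm⟩
  have hpre : (fun z : (ι → E) × E => Function.update z.1 i z.2) ⁻¹' (Set.univ.pi s) =
      (Set.univ.pi (Function.update s i Set.univ)) ×ˢ s i := by
    ext z
    simp only [Set.mem_preimage, Set.mem_univ_pi, Set.mem_prod]
    constructor
    · intro h
      refine ⟨fun k => ?_, by simpa using h i⟩
      by_cases hk : k = i
      · subst hk; simp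
      · simpa [Function.update_of_ne hk] using h k
    · rintro ⟨h1, h2⟩ k
      by_cases hk : k = i
      · subst hk; simpa using h2
      · simpa [Function.update_of_ne hk] using h1 k
  rw [Measure.map_apply hmeas (MeasurableSet.univ_pi hs), hpre, Measure.prod_prod, Measure.pi_pi,
    ← Finset.mul_prod_erase _ _ (Finset.mem_univ i),
    ← Finset.mul_prod_erase Finset.univ (fun k => ν (s k)) (Finset.mem_univ i)]
  simp only [Function.update_self, measure_univ, one_mul]
  rw [mul_comm]
  congr 1
  exact Finset.prod_congr rfl fun k hk => by
    rw [Function.update_of_ne (Finset.ne_of_mem_erase hk)]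

/-- The exponential Markov inequality for a sum of independent identically distributed terms. -/
lemma measure_sum_nonneg_le {ι : Type*} [Fintype ι] {E : Type*} [MeasurableSpace E]
    (ρ : Measure E) [IsProbabilityMeasure ρ] {g : E → ℝ}
    (hint : Integrable (fun y => Real.exp (g y)) ρ) {c : ℝ}
    (hc : ∫ y, Real.exp (g y) ∂ρ ≤ Real.exp c) :
    Measure.pi (fun _ : ι => ρ) {Y | 0 ≤ ∑ j, g (Y j)} ≤
      ENNReal.ofReal (Real.exp (Fintype.card ι * c)) := by
  have hint' : Integrable (fun Y : ι → E => ∏ j, Real.exp (g (Y j))) (Measure.pi fun _ => ρ) :=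
    Integrable.fintype_prod fun _ => hint
  have hle := mul_meas_ge_le_integral_of_nonneg (μ := Measure.pi fun _ : ι => ρ)
    (Filter.Eventually.of_forall fun Y => Finset.prod_nonneg fun j _ => (Real.exp_pos (g (Y j))).le)
    hint' 1
  rw [one_mul, integral_fintype_prod_eq_pow (fun y => Real.exp (g y))] at hle
  have hset : {Y : ι → E | 0 ≤ ∑ j, g (Y j)} = {Y | 1 ≤ ∏ j, Real.exp (g (Y j))} := by
    ext Y
    simp only [Set.mem_ofPred_eq, ← Real.exp_sum, Real.one_le_exp_iff]
  rw [hset, ← ofReal_measureReal]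
  refine ENNReal.ofReal_le_ofReal (hle.trans ?_)
  rw [Real.exp_nat_mul]
  exact pow_le_pow_left₀ (integral_nonneg fun y => (Real.exp_pos _).le) hc _

/-! ### Squares of sub-Gaussian variables -/

lemma integral_exp_sq_gaussianReal {a : ℝ} (ha : a < 1 / 2) :
    Integrable (fun x => Real.exp (a * x ^ 2)) (gaussianReal 0 1) ∧
    ∫ x, Real.exp (a * x ^ 2) ∂(gaussianReal 0 1) = (√(1 - 2 * a))⁻¹ := by
  have hpos : 0 < 1 / 2 - a := by linarith
  have hpdf (x : ℝ) : gaussianPDFReal 0 1 x * Real.exp (a * x ^ 2) =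
      (√(2 * Real.pi))⁻¹ * Real.exp (-(1 / 2 - a) * x ^ 2) := by
    rw [gaussianPDFReal_def]
    simp only [NNReal.coe_one, mul_one, sub_zero]
    rw [mul_assoc, ← Real.exp_add]
    ring_nf
  constructor
  · rw [gaussianReal_of_var_ne_zero _ one_ne_zero,
      integrable_withDensity_iff (measurable_gaussianPDF 0 1)
        (Filter.Eventually.of_forall fun x => gaussianPDF_lt_top)]
    simp only [toReal_gaussianPDF, mul_comm _ (gaussianPDFReal 0 1 _), hpdf]
    exact (integrable_exp_neg_mul_sq hpos).const_mul _
  · rw [integral_gaussianReal_eq_integral_smul one_ne_zero]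
    simp only [smul_eq_mul, hpdf]
    rw [integral_const_mul, integral_gaussian, ← Real.sqrt_inv, ← Real.sqrt_inv,
      ← Real.sqrt_mul (by positivity)]
    congr 1
    have : 1 - 2 * a ≠ 0 := by linarith
    have : 1 / 2 - a ≠ 0 := hpos.ne'
    field_simp

/-- Linearise the square by an auxiliary standard Gaussian `g`: `exp (x ^ 2 / 4)` is the mean of
`exp (x * g / √2)`. After exchanging the integrals, the sub-Gaussian bound leaves the mean of `exp
(g ^ 2 / 4)`, which is `√2`. -/
lemma integral_exp_sq_le_of_hasSubgaussianMGF {Ω : Type*} [MeasurableSpace Ω] {μ : Measure Ω}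
    [IsProbabilityMeasure μ] {X : Ω → ℝ} (hX : HasSubgaussianMGF X 1 μ) (hmeas : Measurable X) :
    Integrable (fun ω => Real.exp (X ω ^ 2 / 4)) μ ∧
    ∫ ω, Real.exp (X ω ^ 2 / 4) ∂μ ≤ √2 := by
  have hgauss (x : ℝ) : ENNReal.ofReal (Real.exp (x ^ 2 / 4)) =
      ∫⁻ g, ENNReal.ofReal (Real.exp (x / √2 * g)) ∂(gaussianReal 0 1) := by
    rw [← ofReal_integral_eq_lintegral_ofReal (integrable_exp_mul_gaussianReal _)
      (Filter.Eventually.of_forall fun g => (Real.exp_pos _).le)]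
    have h := congrFun (mgf_id_gaussianReal (μ := 0) (v := 1)) (x / √2)
    simp only [mgf, id] at h
    rw [h]
    congr 2
    rw [div_pow, Real.sq_sqrt (by norm_num)]
    push_cast
    ring
  have hle : ∫⁻ ω, ENNReal.ofReal (Real.exp (X ω ^ 2 / 4)) ∂μ ≤ ENNReal.ofReal √2 := by
    simp only [hgauss]
    rw [lintegral_lintegral_swap (by fun_prop)]
    have h4 := integral_exp_sq_gaussianReal (a := 1 / 4) (by norm_num)
    have hval : (√(1 - 2 * (1 / 4 : ℝ)))⁻¹ = √2 := by
      rw [← Real.sqrt_inv]; norm_num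
    rw [hval] at h4
    have hrhs := ofReal_integral_eq_lintegral_ofReal h4.1
      (Filter.Eventually.of_forall fun g => (Real.exp_pos _).le)
    rw [h4.2] at hrhs
    rw [hrhs]
    refine lintegral_mono fun g => ?_
    have hg : ∀ ω, X ω / √2 * g = g / √2 * X ω := fun ω => by ring
    simp only [hg]
    rw [← ofReal_integral_eq_lintegral_ofReal (hX.integrable_exp_mul _)
      (Filter.Eventually.of_forall fun ω => (Real.exp_pos _).le)]
    refine ENNReal.ofReal_le_ofReal ((hX.mgf_le _).trans (le_of_eq ?_))
    rw [div_pow, Real.sq_sqrt (by norm_num)]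
    push_cast
    ring_nf
  have hm : Measurable fun ω => Real.exp (X ω ^ 2 / 4) := by fun_prop
  have hint : Integrable (fun ω => Real.exp (X ω ^ 2 / 4)) μ := by
    rw [← lintegral_ofReal_ne_top_iff_integrable hm.aestronglyMeasurable
      (Filter.Eventually.of_forall fun ω => (Real.exp_pos _).le)]
    exact (hle.trans_lt ENNReal.ofReal_lt_top).ne
  refine ⟨hint, ?_⟩
  rw [← ofReal_integral_eq_lintegral_ofReal hint
    (Filter.Eventually.of_forall fun ω => (Real.exp_pos _).le)] at hle
  exact (ENNReal.ofReal_le_ofReal_iff (Real.sqrt_nonneg _)).mp hle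

/-! ### Linear forms in independent entries -/

section LinearForm

variable {ι Ω : Type*} [Fintype ι] [MeasurableSpace Ω] {ν : Measure Ω} [IsProbabilityMeasure ν]
  {X : Ω → ℝ}

lemma memLp_sum_pi (hX : MemLp X 2 ν) (c : ι → ℝ) :
    MemLp (fun ω : ι → Ω => ∑ i, c i * X (ω i)) 2 (Measure.pi fun _ => ν) :=
  memLp_finsetSum _ fun i _ =>
    (hX.const_mul (c i)).comp_measurePreserving (measurePreserving_eval (fun _ => ν) i)

lemma integral_sum_pi (hX : MemLp X 2 ν) (c : ι → ℝ) :
    ∫ ω : ι → Ω, ∑ i, c i * X (ω i) ∂(Measure.pi fun _ => ν) = (∫ x, X x ∂ν) * ∑ i, c i := by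
  have hc (i : ι) : MemLp (fun x => c i * X x) 2 ν := hX.const_mul (c i)
  have hmem (i : ι) : MemLp (fun ω : ι → Ω => c i * X (ω i)) 2 (Measure.pi fun _ => ν) :=
    (hc i).comp_measurePreserving (measurePreserving_eval (fun _ => ν) i)
  rw [integral_finsetSum _ fun i _ => (hmem i).integrable one_le_two, Finset.mul_sum]
  refine Finset.sum_congr rfl fun i _ => ?_
  refine (integral_comp_eval (μ := fun _ : ι => ν) (i := i) (f := fun x => c i * X x)
    (hc i).aestronglyMeasurable).trans ?_
  rw [integral_const_mul, mul_comm]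

lemma integral_sq_sum_pi (hX : MemLp X 2 ν) (c : ι → ℝ) :
    ∫ ω : ι → Ω, (∑ i, c i * X (ω i)) ^ 2 ∂(Measure.pi fun _ => ν) =
      Var[X; ν] * ∑ i, c i ^ 2 + (∫ x, X x ∂ν) ^ 2 * (∑ i, c i) ^ 2 := by
  have hc (i : ι) : MemLp (fun x => c i * X x) 2 ν := hX.const_mul (c i)
  have hsum := memLp_sum_pi hX c
  have hmean := integral_sum_pi hX c
  have hvar := variance_sum_pi (μ := fun _ : ι => ν) (X := fun i x => c i * X x) hc
  have hfun : (∑ i, fun ω : ι → Ω => c i * X (ω i)) = fun ω => ∑ i, c i * X (ω i) := by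
    ext ω; simp
  rw [hfun, variance_eq_sub hsum, hmean] at hvar
  simp only [variance_const_mul] at hvar
  have h2 : (∫ ω : ι → Ω, (∑ i, c i * X (ω i)) ^ 2 ∂(Measure.pi fun _ => ν)) =
      ((∫ x, X x ∂ν) * ∑ i, c i) ^ 2 + ∑ i, c i ^ 2 * Var[X; ν] := by
    rw [← hvar]; simp
  rw [h2, ← Finset.sum_mul]
  ring

end LinearForm

/-- `ν` has mean `m` and variance `v ∈ (0, 1]`, and its centering is sub-Gaussian with
parameter `1`. -/
structure IsEntryLaw (ν : Measure ℝ) (m v : ℝ) : Prop where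
  prob : IsProbabilityMeasure ν
  integral_eq : ∫ x, x ∂ν = m
  variance_eq : Var[fun x => x; ν] = v
  pos : 0 < v
  le_one : v ≤ 1
  subG : HasSubgaussianMGF (fun x => x - m) 1 ν

/-- The second moment of `⟨x, y⟩` for a unit vector `x` and a vector `y` with independent entries
of mean `m` and variance `v`. -/
def secondMoment {n : ℕ} (m v : ℝ) (x : EuclideanSpace ℝ (Fin n)) : ℝ := v + m ^ 2 * sumCoord x ^ 2

/-! ### Squared eigenbasis coordinates of a column with independent entries. -/

section Column

variable {ν : Measure ℝ} {m v : ℝ} {n : ℕ}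
  {u : OrthonormalBasis (Fin n) ℝ (EuclideanSpace ℝ (Fin n))}

lemma IsEntryLaw.secondMoment_pos (hν : IsEntryLaw ν m v) (x : EuclideanSpace ℝ (Fin n)) :
    0 < secondMoment m v x := by
  have := hν.pos
  unfold secondMoment; positivity

lemma sum_sq_ofLp (i : Fin n) : ∑ k, (u i).ofLp k ^ 2 = 1 := by
  rw [← dotProduct_self_eq_one u i]
  exact Finset.sum_congr rfl fun k _ => sq _

lemma IsEntryLaw.memLp (hν : IsEntryLaw ν m v) : MemLp (fun x => x) 2 ν := by
  have := hν.prob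
  have h : (fun x : ℝ => x) = (fun x => x - m) + fun _ => m := by ext x; simp
  rw [h]
  exact (hν.subG.memLp 2).add (memLp_const m)

lemma IsEntryLaw.integral_sq (hν : IsEntryLaw ν m v) (i : Fin n) :
    Integrable (fun y => ((u i).ofLp ⬝ᵥ y) ^ 2) (Measure.pi fun _ : Fin n => ν) ∧
    ∫ y, ((u i).ofLp ⬝ᵥ y) ^ 2 ∂(Measure.pi fun _ : Fin n => ν) = secondMoment m v (u i) := by
  have := hν.prob
  refine ⟨(memLp_sum_pi hν.memLp (u i).ofLp).integrable_sq,
    (integral_sq_sum_pi hν.memLp (u i).ofLp).trans ?_⟩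
  rw [hν.integral_eq, hν.variance_eq, sum_sq_ofLp, mul_one]
  rfl

lemma IsEntryLaw.hasSubgaussianMGF_dotProduct (hν : IsEntryLaw ν m v) (i : Fin n) :
    HasSubgaussianMGF (fun y => (u i).ofLp ⬝ᵥ y - m * sumCoord (u i)) 1
      (Measure.pi fun _ : Fin n => ν) := by
  have := hν.prob
  have hmp (k : Fin n) := measurePreserving_eval (fun _ : Fin n => ν) k
  have hk (k : Fin n) : HasSubgaussianMGF (fun y : Fin n → ℝ => (u i).ofLp k * (y k - m))
      (⟨(u i).ofLp k ^ 2, sq_nonneg _⟩ * 1) (Measure.pi fun _ : Fin n => ν) := by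
    refine HasSubgaussianMGF.const_mul ?_ _
    refine HasSubgaussianMGF.of_map (Y := fun y : Fin n → ℝ => y k) (X := fun x : ℝ => x - m)
      (measurable_pi_apply k).aemeasurable ?_
    have hmap : Measure.map (fun y : Fin n → ℝ => y k) (Measure.pi fun _ => ν) = ν :=
      (hmp k).map_eq
    rw [hmap]
    exact hν.subG
  have hind : iIndepFun (fun (k : Fin n) (y : Fin n → ℝ) => (u i).ofLp k * (y k - m))
      (Measure.pi fun _ : Fin n => ν) :=
    iIndepFun_pi (μ := fun _ : Fin n => ν) (X := fun k x => (u i).ofLp k * (x - m))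
      fun k => by fun_prop
  have h := HasSubgaussianMGF.sum_of_iIndepFun hind (s := Finset.univ) fun k _ => hk k
  convert h using 1
  · funext y
    simp only [dotProduct, sumCoord, Finset.mul_sum, ← Finset.sum_sub_distrib]
    exact Finset.sum_congr rfl fun k _ => by ring
  · ext
    rw [NNReal.coe_sum, NNReal.coe_one]
    exact ((Finset.sum_congr rfl fun k _ => mul_one _).trans (sum_sq_ofLp (u := u) i)).symm

/-- With `z` the coordinate and `a` its mean, `z ^ 2 ≤ 2 * a ^ 2 + 2 * (z - a) ^ 2`. Dividing by the
second moment `v + a ^ 2` makes the first part bounded, however large the mean is, and the centred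
part is sub-Gaussian. -/
lemma IsEntryLaw.integral_exp_sq_le (hν : IsEntryLaw ν m v) (i : Fin n) :
    Integrable (fun y => Real.exp (v / 8 * (((u i).ofLp ⬝ᵥ y) ^ 2 / secondMoment m v (u i))))
      (Measure.pi fun _ : Fin n => ν) ∧
    ∫ y, Real.exp (v / 8 * (((u i).ofLp ⬝ᵥ y) ^ 2 / secondMoment m v (u i)))
      ∂(Measure.pi fun _ : Fin n => ν) ≤ 2 := by
  have := hν.prob
  have hdot : Measurable fun y : Fin n → ℝ => (u i).ofLp ⬝ᵥ y := by
    simp only [dotProduct]; fun_prop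
  obtain ⟨h1, h2⟩ := integral_exp_sq_le_of_hasSubgaussianMGF
    (hν.hasSubgaussianMGF_dotProduct (u := u) i) (hdot.sub_const _)
  have hξ := hν.secondMoment_pos (u i)
  have hpt (y : Fin n → ℝ) :
      Real.exp (v / 8 * (((u i).ofLp ⬝ᵥ y) ^ 2 / secondMoment m v (u i))) ≤
      Real.exp (1 / 4) * Real.exp (((u i).ofLp ⬝ᵥ y - m * sumCoord (u i)) ^ 2 / 4) := by
    rw [← Real.exp_add, Real.exp_le_exp, mul_div_assoc', div_le_iff₀ hξ]
    set z := (u i).ofLp ⬝ᵥ y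
    set a := m * sumCoord (u i)
    have hξ' : secondMoment m v (u i) = v + a ^ 2 := by simp only [secondMoment, a]; ring
    have hsq : z ^ 2 ≤ 2 * a ^ 2 + 2 * (z - a) ^ 2 := by nlinarith [sq_nonneg (z - 2 * a)]
    rw [hξ']
    have hv := hν.pos
    have hv1 := hν.le_one
    have e1 : v * a ^ 2 ≤ a ^ 2 := by nlinarith [sq_nonneg a]
    have e2 : 0 ≤ (z - a) ^ 2 * a ^ 2 := by positivity
    nlinarith
  have hint : Integrable (fun y => Real.exp (v / 8 * (((u i).ofLp ⬝ᵥ y) ^ 2 /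
      secondMoment m v (u i)))) (Measure.pi fun _ : Fin n => ν) := by
    refine (h1.const_mul (Real.exp (1 / 4))).mono' (by fun_prop) ?_
    exact Filter.Eventually.of_forall fun y => by
      rw [Real.norm_eq_abs, abs_of_pos (Real.exp_pos _)]; exact hpt y
  refine ⟨hint, ?_⟩
  calc _ ≤ ∫ y, Real.exp (1 / 4) * Real.exp (((u i).ofLp ⬝ᵥ y - m * sumCoord (u i)) ^ 2 / 4)
        ∂(Measure.pi fun _ : Fin n => ν) := integral_mono hint (h1.const_mul _) hpt
    _ ≤ Real.exp (1 / 4) * √2 := by rw [integral_const_mul]; gcongr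
    _ ≤ √2 * √2 := by
        gcongr
        apply Real.le_sqrt_of_sq_le
        rw [← Real.exp_nat_mul]
        have h : Real.exp ((2 : ℕ) * (1 / 4)) ^ 2 ≤ 2 ^ 2 := by
          rw [← Real.exp_nat_mul]
          have := Real.exp_one_lt_d9
          norm_num
          linarith
        exact le_of_sq_le_sq h (by norm_num)
    _ = 2 := Real.mul_self_sqrt (by norm_num)

/-! ### Quadratic forms in independent entries -/

/-- Jensen's inequality for weights of total mass at most `1`, the missing mass being placed at `0`;
the proof uses the tangent of `exp` at the weighted mean. -/
lemma exp_sum_mul_le {ι : Type*} (s : Finset ι) {a x : ι → ℝ} (ha : ∀ i ∈ s, 0 ≤ a i)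
    (ha1 : ∑ i ∈ s, a i ≤ 1) :
    Real.exp (∑ i ∈ s, a i * x i) ≤ ∑ i ∈ s, a i * Real.exp (x i) + (1 - ∑ i ∈ s, a i) := by
  set M := ∑ i ∈ s, a i * x i
  have h1 (z : ℝ) : Real.exp M * (1 + z - M) ≤ Real.exp z := by
    have := Real.add_one_le_exp (z - M)
    calc Real.exp M * (1 + z - M) ≤ Real.exp M * Real.exp (z - M) := by gcongr; linarith
      _ = Real.exp z := by rw [← Real.exp_add]; congr 1; ring
  have h2 : ∑ i ∈ s, a i * (Real.exp M * (1 + x i - M)) ≤ ∑ i ∈ s, a i * Real.exp (x i) :=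
    Finset.sum_le_sum fun i hi => mul_le_mul_of_nonneg_left (h1 _) (ha i hi)
  have h3 : ∑ i ∈ s, a i * (Real.exp M * (1 + x i - M)) =
      Real.exp M * ((1 - M) * ∑ i ∈ s, a i + M) := by
    rw [mul_add, Finset.mul_sum, Finset.mul_sum, Finset.mul_sum, ← Finset.sum_add_distrib]
    exact Finset.sum_congr rfl fun i _ => by ring
  have h4 := h1 0
  rw [Real.exp_zero] at h4
  nlinarith

/-- The quadratic form with eigenvalues `f` in the eigenbasis `u`. -/
def spectralForm (u : OrthonormalBasis (Fin n) ℝ (EuclideanSpace ℝ (Fin n))) (f : Fin n → ℝ)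
    (y : Fin n → ℝ) : ℝ := ∑ i, f i * ((u i).ofLp ⬝ᵥ y) ^ 2

lemma continuous_spectralForm (f : Fin n → ℝ) : Continuous (spectralForm u f) := by
  unfold spectralForm dotProduct
  fun_prop

lemma abs_spectralForm_le {f w : Fin n → ℝ} (h : ∀ i, |f i| ≤ w i) (y : Fin n → ℝ) :
    |spectralForm u f y| ≤ spectralForm u w y := by
  refine (Finset.abs_sum_le_sum_abs _ _).trans (Finset.sum_le_sum fun i _ => ?_)
  rw [abs_mul, abs_of_nonneg (sq_nonneg ((u i).ofLp ⬝ᵥ y))]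
  gcongr
  exact h i

lemma IsEntryLaw.integral_spectralForm (hν : IsEntryLaw ν m v) (f : Fin n → ℝ) :
    Integrable (spectralForm u f) (Measure.pi fun _ : Fin n => ν) ∧
    ∫ y, spectralForm u f y ∂(Measure.pi fun _ : Fin n => ν) =
      ∑ i, f i * secondMoment m v (u i) := by
  have h (i : Fin n) := hν.integral_sq (u := u) i
  refine ⟨integrable_finsetSum _ fun i _ => (h i).1.const_mul _, ?_⟩
  unfold spectralForm
  rw [integral_finsetSum _ fun i _ => (h i).1.const_mul _]
  exact Finset.sum_congr rfl fun i _ => by rw [integral_const_mul, (h i).2]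

/-- Jensen reduces the form to its individual squares, so no independence between the coordinates
`⟨u i, y⟩` is needed. -/
lemma IsEntryLaw.integral_exp_spectralForm_le (hν : IsEntryLaw ν m v) {w : Fin n → ℝ}
    (hw : ∀ i, 0 ≤ w i) {W : ℝ} (hW : 0 < W) (hwW : ∑ i, w i * secondMoment m v (u i) ≤ W) :
    Integrable (fun y => Real.exp (v / 8 * (spectralForm u w y / W)))
      (Measure.pi fun _ : Fin n => ν) ∧
    ∫ y, Real.exp (v / 8 * (spectralForm u w y / W)) ∂(Measure.pi fun _ : Fin n => ν) ≤ 2 := by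
  have := hν.prob
  set a : Fin n → ℝ := fun i => w i * secondMoment m v (u i) / W
  have ha (i) : 0 ≤ a i := div_nonneg (mul_nonneg (hw i) (hν.secondMoment_pos _).le) hW.le
  have ha1 : ∑ i, a i ≤ 1 := by
    simp only [a]
    rw [← Finset.sum_div, div_le_one hW]; exact hwW
  set x : Fin n → (Fin n → ℝ) → ℝ := fun i y =>
    v / 8 * (((u i).ofLp ⬝ᵥ y) ^ 2 / secondMoment m v (u i))
  have hax (y) : v / 8 * (spectralForm u w y / W) = ∑ i, a i * x i y := by
    simp only [spectralForm, a, x]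
    rw [Finset.sum_div, Finset.mul_sum]
    refine Finset.sum_congr rfl fun i _ => ?_
    have := (hν.secondMoment_pos (u i)).ne'
    field_simp
  have hpt (y) : Real.exp (v / 8 * (spectralForm u w y / W)) ≤
      ∑ i, a i * Real.exp (x i y) + (1 - ∑ i, a i) := by
    rw [hax]
    exact exp_sum_mul_le _ (fun i _ => ha i) ha1
  have hi (i : Fin n) := hν.integral_exp_sq_le (u := u) i
  have hsum : Integrable (fun y => ∑ i, a i * Real.exp (x i y))
      (Measure.pi fun _ : Fin n => ν) := integrable_finsetSum _ fun i _ => (hi i).1.const_mul _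
  have hbound := hsum.add (integrable_const (1 - ∑ i, a i))
  have hint : Integrable (fun y => Real.exp (v / 8 * (spectralForm u w y / W)))
      (Measure.pi fun _ : Fin n => ν) := by
    have hc := continuous_spectralForm (u := u) w
    refine hbound.mono' (by fun_prop) (Filter.Eventually.of_forall fun y => ?_)
    rw [Real.norm_eq_abs, abs_of_pos (Real.exp_pos _)]; exact hpt y
  refine ⟨hint, (integral_mono hint hbound hpt).trans ?_⟩
  simp only [Pi.add_apply]
  rw [integral_add hsum (integrable_const _), integral_const,
    integral_finsetSum _ fun i _ => (hi i).1.const_mul _]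
  have h2 : ∑ i, ∫ y, a i * Real.exp (x i y) ∂(Measure.pi fun _ : Fin n => ν) ≤
      ∑ i, a i * 2 := Finset.sum_le_sum fun i _ => by
    rw [integral_const_mul]
    exact mul_le_mul_of_nonneg_left (hi i).2 (ha i)
  rw [← Finset.sum_mul] at h2
  simp only [probReal_univ, one_smul]
  linarith

lemma exp_le_one_add_add_sq_mul_exp_abs (x : ℝ) :
    Real.exp x ≤ 1 + x + x ^ 2 * Real.exp |x| := by
  have h := Complex.norm_exp_sub_sum_le_norm_mul_exp x 2
  rw [← Complex.ofReal_exp, Finset.sum_range_succ, Finset.sum_range_one] at h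
  have h2 : (Real.exp x : ℂ) - ((x : ℂ) ^ 0 / (Nat.factorial 0 : ℂ) +
      (x : ℂ) ^ 1 / (Nat.factorial 1 : ℂ)) = ((Real.exp x - (1 + x) : ℝ) : ℂ) := by
    simp
  rw [h2, Complex.norm_real, Complex.norm_real, Real.norm_eq_abs, Real.norm_eq_abs, sq_abs] at h
  linarith [le_abs_self (Real.exp x - (1 + x))]

/-- Second-order Taylor bound; as `r * U ≤ U / 2`, the remaining half of `exp U` absorbs the factor
`U ^ 2`. -/
lemma exp_neg_mul_le {r U Z : ℝ} (hr : 0 ≤ r) (hr2 : r ≤ 1 / 2) (hZ : |Z| ≤ U) :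
    Real.exp (-(r * Z)) ≤ 1 - r * Z + 8 * r ^ 2 * Real.exp U := by
  have hU : 0 ≤ U := (abs_nonneg _).trans hZ
  have hx : |-(r * Z)| ≤ r * U := by rw [abs_neg, abs_mul, abs_of_nonneg hr]; gcongr
  have h1 : Real.exp (-(r * Z)) ≤ 1 + -(r * Z) + (r * U) ^ 2 * Real.exp (r * U) := by
    refine (exp_le_one_add_add_sq_mul_exp_abs _).trans ?_
    rw [← sq_abs]
    gcongr
  have h2 : Real.exp (r * U) ≤ Real.exp (U / 2) := by
    rw [Real.exp_le_exp]; nlinarith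
  have h3 : U ^ 2 ≤ 8 * Real.exp (U / 2) := by
    have := Real.quadratic_le_exp_of_nonneg (x := U / 2) (by positivity)
    nlinarith
  have h4 : Real.exp U = Real.exp (U / 2) * Real.exp (U / 2) := by
    rw [← Real.exp_add]; ring_nf
  have h5 : U ^ 2 * Real.exp (r * U) ≤ 8 * Real.exp U := by
    rw [h4, ← mul_assoc]
    gcongr
  have h6 : r ^ 2 * (U ^ 2 * Real.exp (r * U)) ≤ r ^ 2 * (8 * Real.exp U) := by gcongr
  nlinarith

lemma IsEntryLaw.integral_exp_neg_spectralForm_le (hν : IsEntryLaw ν m v) {f w : Fin n → ℝ}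
    (hfw : ∀ i, |f i| ≤ w i) {W η : ℝ} (hW : 0 < W)
    (hwW : ∑ i, w i * secondMoment m v (u i) ≤ W) (hη : 0 < η) (hη1 : η ≤ 1)
    (hfη : η * W ≤ ∑ i, f i * secondMoment m v (u i)) :
    Integrable (fun y => Real.exp (-(v * η / 256 * (v / 8 * (spectralForm u f y / W)))))
      (Measure.pi fun _ : Fin n => ν) ∧
    ∫ y, Real.exp (-(v * η / 256 * (v / 8 * (spectralForm u f y / W))))
      ∂(Measure.pi fun _ : Fin n => ν) ≤ Real.exp (-(v ^ 2 * η ^ 2 / 4096)) := by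
  have := hν.prob
  have hv := hν.pos
  have hv1 := hν.le_one
  -- This `r` maximises `r * v * η / 8 - 16 * r ^ 2`, the guaranteed drift minus the second-order
  -- error.
  set r := v * η / 256 with hr
  have hr0 : 0 < r := by positivity
  have hr2 : r ≤ 1 / 2 := by
    have : v * η ≤ 1 := mul_le_one₀ hv1 hη.le hη1
    linarith
  have hw (i) : 0 ≤ w i := (abs_nonneg _).trans (hfw i)
  obtain ⟨hE, hE2⟩ := hν.integral_exp_spectralForm_le (u := u) hw hW hwW
  obtain ⟨hV, hVm⟩ := hν.integral_spectralForm (u := u) f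
  have hpt (y : Fin n → ℝ) : Real.exp (-(r * (v / 8 * (spectralForm u f y / W)))) ≤
      1 - r * (v / 8 * (spectralForm u f y / W)) +
        8 * r ^ 2 * Real.exp (v / 8 * (spectralForm u w y / W)) := by
    refine exp_neg_mul_le hr0.le hr2 ?_
    rw [abs_mul, abs_of_pos (by positivity : 0 < v / 8), abs_div, abs_of_pos hW]
    have := abs_spectralForm_le (u := u) hfw y
    gcongr
  have hVi : Integrable (fun y => r * (v / 8 * (spectralForm u f y / W)))
      (Measure.pi fun _ : Fin n => ν) := ((hV.div_const W).const_mul _).const_mul _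
  have hEi := hE.const_mul (8 * r ^ 2)
  have h1V := (integrable_const (μ := Measure.pi fun _ : Fin n => ν) (1 : ℝ)).sub hVi
  have hint : Integrable (fun y => Real.exp (-(r * (v / 8 * (spectralForm u f y / W)))))
      (Measure.pi fun _ : Fin n => ν) := by
    have hc := continuous_spectralForm (u := u) f
    refine (h1V.add hEi).mono' (by fun_prop) (Filter.Eventually.of_forall fun y => ?_)
    rw [Real.norm_eq_abs, abs_of_pos (Real.exp_pos _)]; exact hpt y
  refine ⟨hint, (integral_mono hint (h1V.add hEi) hpt).trans ?_⟩
  simp only [Pi.add_apply, Pi.sub_apply]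
  rw [integral_add (show Integrable (fun y => 1 - r * (v / 8 * (spectralForm u f y / W))) _
    from h1V) hEi, integral_sub (integrable_const _) hVi, integral_const_mul, integral_const_mul,
    integral_const_mul, integral_div, integral_const, hVm]
  simp only [probReal_univ, one_smul]
  have h3 : η ≤ (∑ i, f i * secondMoment m v (u i)) / W := (le_div_iff₀ hW).mpr hfη
  have h4 : r * (v / 8 * η) ≤ r * (v / 8 * ((∑ i, f i * secondMoment m v (u i)) / W)) := by
    gcongr
  have h5 : 8 * r ^ 2 * ∫ y, Real.exp (v / 8 * (spectralForm u w y / W))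
      ∂(Measure.pi fun _ : Fin n => ν) ≤ 8 * r ^ 2 * 2 := by gcongr
  have h6 := Real.add_one_le_exp (-(v ^ 2 * η ^ 2 / 4096))
  have h7 : r * (v / 8 * η) = v ^ 2 * η ^ 2 / 2048 := by rw [hr]; ring
  have h8 : 8 * r ^ 2 * 2 = v ^ 2 * η ^ 2 / 4096 := by rw [hr]; ring
  linarith

/-- A spectral form with large positive mean is positive on average over independent columns. -/
lemma IsEntryLaw.measure_sum_spectralForm_nonpos_le (hν : IsEntryLaw ν m v) {ι : Type*}
    [Fintype ι] {f w : Fin n → ℝ} (hfw : ∀ i, |f i| ≤ w i) {W η : ℝ} (hW : 0 < W)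
    (hwW : ∑ i, w i * secondMoment m v (u i) ≤ W) (hη : 0 < η) (hη1 : η ≤ 1)
    (hfη : η * W ≤ ∑ i, f i * secondMoment m v (u i)) :
    Measure.pi (fun _ : ι => Measure.pi fun _ : Fin n => ν)
        {Y | ∑ j, spectralForm u f (Y j) ≤ 0} ≤
      ENNReal.ofReal (Real.exp (Fintype.card ι * -(v ^ 2 * η ^ 2 / 4096))) := by
  have := hν.prob
  have hv := hν.pos
  obtain ⟨h1, h2⟩ := hν.integral_exp_neg_spectralForm_le hfw hW hwW hη hη1 hfη
  refine le_trans (measure_mono fun Y hY => ?_) (measure_sum_nonneg_le _ h1 h2)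
  rw [Set.mem_ofPred_eq] at hY ⊢
  rw [Finset.sum_neg_distrib, ← Finset.mul_sum, ← Finset.mul_sum, ← Finset.sum_div]
  have h3 : (∑ j, spectralForm u f (Y j)) / W ≤ 0 := div_nonpos_of_nonpos_of_nonneg hY hW.le
  have h4 : 0 < v * η / 256 := by positivity
  have h5 : 0 < v / 8 := by positivity
  rw [neg_nonneg]
  exact mul_nonpos_of_nonneg_of_nonpos h4.le (mul_nonpos_of_nonneg_of_nonpos h5.le h3)

/-- A nonnegative spectral form is on average at most a constant multiple of its mean. -/
lemma IsEntryLaw.measure_le_sum_spectralForm_le (hν : IsEntryLaw ν m v) {ι : Type*}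
    [Fintype ι] {w : Fin n → ℝ} (hw : ∀ i, 0 ≤ w i) {W : ℝ} (hW : 0 < W)
    (hwW : ∑ i, w i * secondMoment m v (u i) ≤ W) :
    Measure.pi (fun _ : ι => Measure.pi fun _ : Fin n => ν)
        {Y | 16 / v * W * Fintype.card ι ≤ ∑ j, spectralForm u w (Y j)} ≤
      ENNReal.ofReal (Real.exp (-(Fintype.card ι : ℝ))) := by
  have := hν.prob
  have hv := hν.pos
  obtain ⟨h1, h2⟩ := hν.integral_exp_spectralForm_le (u := u) hw hW hwW
  have h3 (y : Fin n → ℝ) : Real.exp (v / 8 * (spectralForm u w y / W) - 2) =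
      Real.exp (v / 8 * (spectralForm u w y / W)) * Real.exp (-2) := by
    rw [← Real.exp_add]; rfl
  have h4 : Integrable (fun y => Real.exp (v / 8 * (spectralForm u w y / W) - 2))
      (Measure.pi fun _ : Fin n => ν) := by
    simp only [h3]; exact h1.mul_const _
  have h5 : ∫ y, Real.exp (v / 8 * (spectralForm u w y / W) - 2)
      ∂(Measure.pi fun _ : Fin n => ν) ≤ Real.exp (-1) := by
    simp only [h3]
    rw [integral_mul_const]
    have h2e : (2 : ℝ) ≤ Real.exp 1 := by have := Real.add_one_le_exp (1 : ℝ); linarith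
    calc _ ≤ Real.exp 1 * Real.exp (-2) := by
          gcongr; exact h2.trans h2e
      _ = Real.exp (-1) := by rw [← Real.exp_add]; norm_num
  have h6 := measure_sum_nonneg_le (ι := ι) _ h4 h5
  rw [mul_neg_one] at h6
  refine le_trans (measure_mono fun Y hY => ?_) h6
  rw [Set.mem_ofPred_eq] at hY ⊢
  rw [Finset.sum_sub_distrib, ← Finset.mul_sum, ← Finset.sum_div, Finset.sum_const,
    Finset.card_univ, nsmul_eq_mul, sub_nonneg, mul_div_assoc', le_div_iff₀ hW]
  have : v / 8 * (16 / v * W * Fintype.card ι) ≤ v / 8 * ∑ j, spectralForm u w (Y j) := by gcongr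
  have e : v / 8 * (16 / v * W * Fintype.card ι) = Fintype.card ι * 2 * W := by
    field_simp; ring
  linarith

end Column

/-! ### Gaussian entries -/

lemma isEntryLaw_gaussianReal : IsEntryLaw (gaussianReal 0 1) 0 1 where
  prob := inferInstance
  integral_eq := integral_id_gaussianReal
  variance_eq := by rw [variance_fun_id_gaussianReal]; rfl
  pos := one_pos
  le_one := le_rfl
  subG := by
    simp only [sub_zero]
    refine ⟨fun t => integrable_exp_mul_gaussianReal t, fun t => le_of_eq ?_⟩
    rw [mgf_fun_id_gaussianReal]
    simp

/-! ### Rotations of Gaussian vectors -/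

section Gaussian

variable {ι : Type*} [Fintype ι]

lemma measurePreserving_sum_smul_gaussian
    (b : OrthonormalBasis ι ℝ (EuclideanSpace ℝ ι)) :
    MeasurePreserving (fun (x : ι → ℝ) => ∑ i, x i • (b i).ofLp)
      (Measure.pi fun _ => gaussianReal 0 1) (Measure.pi fun _ => gaussianReal 0 1) := by
  classical
  refine ⟨by fun_prop, ?_⟩
  have h1 := (map_pi_eq_stdGaussian (ι := ι)).trans (stdGaussian_eq_map_pi_orthonormalBasis b)
  have h2 := congrArg (Measure.map (WithLp.ofLp : EuclideanSpace ℝ ι → ι → ℝ)) h1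
  have hm : Measurable (WithLp.ofLp : EuclideanSpace ℝ ι → ι → ℝ) := by fun_prop
  rw [Measure.map_map hm (by fun_prop), Measure.map_map hm (by fun_prop)] at h2
  have e1 : (WithLp.ofLp : EuclideanSpace ℝ ι → ι → ℝ) ∘ WithLp.toLp 2 = id := rfl
  have e2 : (WithLp.ofLp : EuclideanSpace ℝ ι → ι → ℝ) ∘ (fun x : ι → ℝ => ∑ i, x i • b i) =
      fun x => ∑ i, x i • (b i).ofLp := by
    funext x; simp
  rw [e1, e2, Measure.map_id] at h2
  exact h2.symm

lemma basis_dotProduct_sum (b : OrthonormalBasis ι ℝ (EuclideanSpace ℝ ι)) (x : ι → ℝ) (j : ι) :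
    (b j).ofLp ⬝ᵥ (∑ i, x i • (b i).ofLp) = x j := by
  classical
  rw [dotProduct_sum]
  simp only [dotProduct_smul, smul_eq_mul]
  have h (i : ι) : (b j).ofLp ⬝ᵥ (b i).ofLp = if j = i then 1 else 0 := by
    rw [← orthonormal_iff_ite.mp b.orthonormal j i]
    simp [PiLp.inner_apply, dotProduct, mul_comm]
  simp [h]

lemma measurePreserving_dotProduct_gaussian (b : OrthonormalBasis ι ℝ (EuclideanSpace ℝ ι)) :
    MeasurePreserving (fun (g : ι → ℝ) (j : ι) => (b j).ofLp ⬝ᵥ g)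
      (Measure.pi fun _ => gaussianReal 0 1) (Measure.pi fun _ => gaussianReal 0 1) := by
  have hs := measurePreserving_sum_smul_gaussian b
  have hm : Measurable (fun (g : ι → ℝ) (j : ι) => (b j).ofLp ⬝ᵥ g) := by
    simp only [dotProduct]; fun_prop
  refine ⟨hm, ?_⟩
  conv_lhs => rw [← hs.map_eq]
  rw [Measure.map_map hm hs.measurable]
  have e : (fun (g : ι → ℝ) (j : ι) => (b j).ofLp ⬝ᵥ g) ∘
      (fun x : ι → ℝ => ∑ i, x i • (b i).ofLp) = id := by
    funext x j
    exact basis_dotProduct_sum b x j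
  rw [e, Measure.map_id]

lemma measure_sum_sq_gaussian_le :
    Measure.pi (fun _ : ι => gaussianReal 0 1) {x | ∑ j, x j ^ 2 ≤ Fintype.card ι / 4} ≤
      ENNReal.ofReal (Real.exp (-(Fintype.card ι / 4 : ℝ))) := by
  -- Chernoff parameter `3 / 2` makes the Gaussian integral exactly `1 / 2`; what is left to check
  -- is `exp (5 / 8) ≤ 2`.
  obtain ⟨h1, h2⟩ := integral_exp_sq_gaussianReal (a := -(3 / 2)) (by norm_num)
  have h3 (x : ℝ) : Real.exp (3 / 8 - 3 / 2 * x ^ 2) =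
      Real.exp (3 / 8) * Real.exp (-(3 / 2) * x ^ 2) := by
    rw [← Real.exp_add]; ring_nf
  have h4 : Integrable (fun x => Real.exp (3 / 8 - 3 / 2 * x ^ 2)) (gaussianReal 0 1) := by
    simp only [h3]; exact h1.const_mul _
  have h5 : ∫ x, Real.exp (3 / 8 - 3 / 2 * x ^ 2) ∂(gaussianReal 0 1) ≤
      Real.exp (-(1 / 4)) := by
    simp only [h3]
    rw [integral_const_mul, h2]
    have e4 : √(1 - 2 * (-(3 / 2) : ℝ)) = 2 := by
      rw [show (1 - 2 * (-(3 / 2)) : ℝ) = 2 ^ 2 by norm_num]; exact Real.sqrt_sq (by norm_num)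
    rw [e4, ← div_eq_mul_inv, div_le_iff₀ (by norm_num)]
    have h6 : Real.exp (5 / 8) ≤ 2 := by
      refine le_of_pow_le_pow_left₀ (n := 8) (by norm_num) (by norm_num) ?_
      rw [← Real.exp_nat_mul, show ((8 : ℕ) : ℝ) * (5 / 8) = ((5 : ℕ) : ℝ) * 1 by norm_num,
        Real.exp_nat_mul]
      have h7 : Real.exp 1 ≤ 2.7182818286 := Real.exp_one_lt_d9.le
      calc Real.exp 1 ^ 5 ≤ 2.7182818286 ^ 5 := by gcongr
        _ ≤ 2 ^ 8 := by norm_num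
    calc Real.exp (3 / 8) = Real.exp (-(1 / 4)) * Real.exp (5 / 8) := by
          rw [← Real.exp_add]; norm_num
      _ ≤ _ := by gcongr
  refine le_trans (measure_mono fun x hx => ?_)
    ((measure_sum_nonneg_le (ι := ι) _ h4 h5).trans (le_of_eq ?_))
  · rw [Set.mem_ofPred_eq] at hx ⊢
    rw [Finset.sum_sub_distrib, ← Finset.mul_sum, Finset.sum_const, Finset.card_univ,
      nsmul_eq_mul]
    linarith
  · congr 2; ring

lemma measure_sum_sq_projection_le (b : OrthonormalBasis ι ℝ (EuclideanSpace ℝ ι))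
    (s : Finset ι) :
    Measure.pi (fun _ : ι => gaussianReal 0 1)
        {g | ∑ j ∈ s, ((b j).ofLp ⬝ᵥ g) ^ 2 ≤ s.card / 4} ≤
      ENNReal.ofReal (Real.exp (-(s.card / 4 : ℝ))) := by
  classical
  have hmp := (measurePreserving_subtype_restrict (fun _ : ι => gaussianReal 0 1) (· ∈ s)).comp
    (measurePreserving_dotProduct_gaussian b)
  have hmeas : MeasurableSet {x : {j // j ∈ s} → ℝ | ∑ j, x j ^ 2 ≤ (s.card : ℝ) / 4} :=
    measurableSet_le (by fun_prop) measurable_const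
  have h := hmp.measure_preimage hmeas.nullMeasurableSet
  have hchi := measure_sum_sq_gaussian_le (ι := {j // j ∈ s})
  rw [Fintype.card_coe] at hchi
  refine le_trans (le_of_eq ?_) (h.trans_le (le_trans (le_of_eq ?_) hchi))
  · congr 1
    ext g
    simp only [Set.mem_ofPred_eq, Set.mem_preimage, Function.comp]
    rw [Finset.sum_subtype s (fun _ => Iff.rfl) fun j => ((b j).ofLp ⬝ᵥ g) ^ 2]
  · congr!

/-- In the coordinates of `u`, which are again i.i.d. Gaussian, this map just updates coordinate
`k`. It expresses that the `u k`-component is independent of the others, so it may be drawn last. -/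
lemma measurePreserving_resample {n : ℕ} (u : OrthonormalBasis (Fin n) ℝ (EuclideanSpace ℝ (Fin n)))
    (k : Fin n) :
    MeasurePreserving
      (fun z : (Fin n → ℝ) × ℝ => z.1 + (z.2 - (u k).ofLp ⬝ᵥ z.1) • (u k).ofLp)
      ((Measure.pi fun _ => gaussianReal 0 1).prod (gaussianReal 0 1))
      (Measure.pi fun _ => gaussianReal 0 1) := by
  have hs := measurePreserving_sum_smul_gaussian u
  have hsid := hs.prod (MeasurePreserving.id (gaussianReal 0 1))
  have hm : Measurable
      (fun z : (Fin n → ℝ) × ℝ => z.1 + (z.2 - (u k).ofLp ⬝ᵥ z.1) • (u k).ofLp) := by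
    simp only [dotProduct]; fun_prop
  refine ⟨hm, ?_⟩
  conv_lhs => rw [← hsid.map_eq]
  rw [Measure.map_map hm hsid.measurable]
  have e : (fun z : (Fin n → ℝ) × ℝ => z.1 + (z.2 - (u k).ofLp ⬝ᵥ z.1) • (u k).ofLp) ∘
      Prod.map (fun x : Fin n → ℝ => ∑ i, x i • (u i).ofLp) id =
      (fun x : Fin n → ℝ => ∑ i, x i • (u i).ofLp) ∘
        fun z : (Fin n → ℝ) × ℝ => Function.update z.1 k z.2 := by
    funext z
    simp only [Function.comp, Prod.map_fst, Prod.map_snd, id, basis_dotProduct_sum]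
    have hupd : ∑ i ∈ Finset.univ.erase k, Function.update z.1 k z.2 i • (u i).ofLp =
        ∑ i ∈ Finset.univ.erase k, z.1 i • (u i).ofLp :=
      Finset.sum_congr rfl fun i hi => by rw [Function.update_of_ne (Finset.ne_of_mem_erase hi)]
    rw [← Finset.add_sum_erase _ (fun i => z.1 i • (u i).ofLp) (Finset.mem_univ k),
      ← Finset.add_sum_erase _ (fun i => Function.update z.1 k z.2 i • (u i).ofLp)
        (Finset.mem_univ k), Function.update_self, hupd]
    module
  rw [e]
  exact (hs.comp (measurePreserving_update_pi (gaussianReal 0 1) k)).map_eq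

lemma measurePreserving_resample_pi {n : ℕ}
    (u : OrthonormalBasis (Fin n) ℝ (EuclideanSpace ℝ (Fin n))) (k : Fin n) :
    MeasurePreserving
      (fun (z : (ι → Fin n → ℝ) × (ι → ℝ)) (j : ι) =>
        z.1 j + (z.2 j - (u k).ofLp ⬝ᵥ z.1 j) • (u k).ofLp)
      ((Measure.pi fun _ => Measure.pi fun _ => gaussianReal 0 1).prod
        (Measure.pi fun _ => gaussianReal 0 1))
      (Measure.pi fun _ => Measure.pi fun _ => gaussianReal 0 1) := by
  have h1 := (measurePreserving_arrowProdEquivProdArrow (Fin n → ℝ) ℝ ι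
    (fun _ => Measure.pi fun _ => gaussianReal 0 1) (fun _ => gaussianReal 0 1)).symm
  have h2 := measurePreserving_pi
    (fun _ : ι => (Measure.pi fun _ : Fin n => gaussianReal 0 1).prod (gaussianReal 0 1))
    (fun _ => Measure.pi fun _ => gaussianReal 0 1) fun _ => measurePreserving_resample u k
  exact h2.comp h1

/-! ### Small eigenspaces of a matrix of small trace -/

/-- By Markov's inequality at most half of the eigenvalues exceed `2 * θ`. The vector `a` is the
projection of `g` to the span of the remaining eigenvectors, so `a ⬝ᵥ g` is its squared length. -/
lemma exists_quadForm_le_of_trace_le [DecidableEq ι] {N : Matrix ι ι ℝ} (hN : N.PosSemidef)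
    {θ : ℝ} (hθ : 0 < θ) (htr : N.trace ≤ θ * Fintype.card ι) :
    ∃ (b : OrthonormalBasis ι ℝ (EuclideanSpace ℝ ι)) (s : Finset ι),
      (Fintype.card ι : ℝ) / 2 ≤ s.card ∧ ∀ g : ι → ℝ, ∃ a : ι → ℝ,
        a ⬝ᵥ g = ∑ j ∈ s, ((b j).ofLp ⬝ᵥ g) ^ 2 ∧
        a ⬝ᵥ (N *ᵥ a) ≤ 2 * θ * ∑ j ∈ s, ((b j).ofLp ⬝ᵥ g) ^ 2 := by
  have hH := hN.isHermitian
  set b := hH.eigenvectorBasis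
  set s := Finset.univ.filter fun j => hH.eigenvalues j ≤ 2 * θ
  refine ⟨b, s, ?_, fun g => ⟨∑ j ∈ s, ((b j).ofLp ⬝ᵥ g) • (b j).ofLp, ?_, ?_⟩⟩
  · have h0 (j : ι) : 0 ≤ hH.eigenvalues j := hN.eigenvalues_nonneg j
    have h1 : N.trace = ∑ j, hH.eigenvalues j := by
      rw [hH.trace_eq_sum_eigenvalues]; simp
    have h2 : (2 * θ) * ((Finset.univ.filter fun j => ¬ hH.eigenvalues j ≤ 2 * θ).card : ℝ) ≤
        N.trace := by
      rw [h1, mul_comm, ← nsmul_eq_mul]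
      refine (Finset.card_nsmul_le_sum _ _ _ fun j hj => ?_).trans
        (Finset.sum_le_sum_of_subset_of_nonneg (Finset.filter_subset _ _) fun j _ _ => h0 j)
      exact (not_le.mp (Finset.mem_filter.mp hj).2).le
    have h3 := Finset.card_filter_add_card_filter_not (s := (Finset.univ : Finset ι))
      (fun j => hH.eigenvalues j ≤ 2 * θ)
    have h4 : (s.card : ℝ) + ((Finset.univ.filter fun j => ¬ hH.eigenvalues j ≤ 2 * θ).card : ℝ) =
        Fintype.card ι := by exact_mod_cast h3
    nlinarith
  · rw [sum_dotProduct]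
    exact Finset.sum_congr rfl fun j _ => by rw [smul_dotProduct, smul_eq_mul, sq]
  · have hb (j : ι) : N *ᵥ (b j).ofLp = hH.eigenvalues j • (b j).ofLp :=
      hH.mulVec_eigenvectorBasis j
    have hbb (i j : ι) : (b j).ofLp ⬝ᵥ (b i).ofLp = if j = i then 1 else 0 := by
      rw [← orthonormal_iff_ite.mp b.orthonormal j i]
      simp [PiLp.inner_apply, dotProduct, mul_comm]
    rw [mulVec_sum, sum_dotProduct, Finset.mul_sum]
    refine Finset.sum_le_sum fun j hj => ?_
    rw [smul_dotProduct, dotProduct_sum]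
    simp only [mulVec_smul, hb, dotProduct_smul, hbb, smul_eq_mul]
    have : ∑ i ∈ s, (b i).ofLp ⬝ᵥ g * (hH.eigenvalues i * if j = i then 1 else 0) =
        (b j).ofLp ⬝ᵥ g * hH.eigenvalues j := by
      rw [Finset.sum_eq_single_of_mem j hj fun i _ hij => by rw [if_neg (Ne.symm hij)]; ring]
      simp
    rw [this]
    have hle : hH.eigenvalues j ≤ 2 * θ := (Finset.mem_filter.mp hj).2
    nlinarith [sq_nonneg ((b j).ofLp ⬝ᵥ g)]

/-- If the eigenvalue at `k` is bounded below and all the others have small sum, then Gaussian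
columns are certified with high probability. -/
lemma measure_uncertified_gaussian_le {n : ℕ}
    (u : OrthonormalBasis (Fin n) ℝ (EuclideanSpace ℝ (Fin n))) (k : Fin n) {f w : Fin n → ℝ}
    (hw : ∀ i, 0 ≤ w i) (hwk : w k = 0) (hfw : ∀ i, i ≠ k → -w i ≤ f i) (hfk : 1 / 2 ≤ f k)
    (hι : 0 < Fintype.card ι)
    (hsum : ∑ i, w i ≤ Fintype.card ι / 512) :
    Measure.pi (fun _ : ι => Measure.pi fun _ : Fin n => gaussianReal 0 1) (uncertified ι f u) ≤
      ENNReal.ofReal (Real.exp (-(Fintype.card ι : ℝ))) +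
        ENNReal.ofReal (Real.exp (-(Fintype.card ι / 8 : ℝ))) := by
  classical
  set m : ℝ := ((Fintype.card ι : ℕ) : ℝ) with hm
  have hm0 : 0 < m := Nat.cast_pos.mpr hι
  have hmp := measurePreserving_resample_pi (ι := ι) u k
  have hT := (isClosed_uncertified ι f u).measurableSet
  -- Condition on `Y`, which fixes all coordinates except those along `u k`; the latter are the
  -- fresh vector `g`.
  rw [← hmp.measure_preimage hT.nullMeasurableSet, Measure.prod_apply (hmp.measurable hT)]
  -- The threshold is `m ^ 2 / 32`, that is `θ * m` for the trace bound `θ = m / 32` used below.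
  set bad : Set (ι → Fin n → ℝ) := {Y | 16 / 1 * (m / 512) * m ≤ ∑ j, spectralForm u w (Y j)}
  have hbad : MeasurableSet bad := by
    have hc := continuous_spectralForm (u := u) w
    exact measurableSet_le measurable_const (by fun_prop)
  have hbad_le := isEntryLaw_gaussianReal.measure_le_sum_spectralForm_le (u := u) (ι := ι) hw
    (W := m / 512) (by positivity) (by simpa [secondMoment] using hsum)
  have hpt (Y : ι → Fin n → ℝ) :
      Measure.pi (fun _ : ι => gaussianReal 0 1) (Prod.mk Y ⁻¹'
        ((fun (z : (ι → Fin n → ℝ) × (ι → ℝ)) (j : ι) =>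
          z.1 j + (z.2 j - (u k).ofLp ⬝ᵥ z.1 j) • (u k).ofLp) ⁻¹' uncertified ι f u)) ≤
      bad.indicator 1 Y + ENNReal.ofReal (Real.exp (-(m / 8))) := by
    by_cases hY : Y ∈ bad
    · rw [Set.indicator_of_mem hY]
      exact prob_le_one.trans (le_add_of_nonneg_right zero_le)
    rw [Set.indicator_of_notMem hY, zero_add]
    have hY' : ∑ j, spectralForm u w (Y j) < 16 / 1 * (m / 512) * m := not_le.mp hY
    set X : Matrix ι (Fin n) ℝ := Matrix.of fun j i => √(w i) * ((u i).ofLp ⬝ᵥ Y j)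
    have hquad (a : ι → ℝ) : a ⬝ᵥ ((X * Xᴴ) *ᵥ a) =
        ∑ i, w i * (∑ j, a j * ((u i).ofLp ⬝ᵥ Y j)) ^ 2 := by
      rw [conjTranspose_eq_transpose_of_trivial, ← mulVec_mulVec, dotProduct_mulVec,
        ← mulVec_transpose]
      refine Finset.sum_congr rfl fun i _ => ?_
      have : (Xᵀ *ᵥ a) i = √(w i) * ∑ j, a j * ((u i).ofLp ⬝ᵥ Y j) := by
        simp only [X, mulVec, dotProduct, transpose_apply, Matrix.of_apply]
        rw [Finset.mul_sum]
        exact Finset.sum_congr rfl fun j _ => by ring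
      rw [this, mul_mul_mul_comm, Real.mul_self_sqrt (hw i), sq]
    have htrace : (X * Xᴴ).trace = ∑ j, spectralForm u w (Y j) := by
      rw [conjTranspose_eq_transpose_of_trivial]
      simp only [trace, diag_apply, mul_apply, transpose_apply, X, Matrix.of_apply, spectralForm]
      refine Finset.sum_congr rfl fun j _ => Finset.sum_congr rfl fun i _ => ?_
      rw [mul_mul_mul_comm, Real.mul_self_sqrt (hw i), sq]
    obtain ⟨b, s, hs, hex⟩ := exists_quadForm_le_of_trace_le (posSemidef_self_mul_conjTranspose X)
      (θ := m / 32) (by positivity) (by rw [htrace, ← hm]; linarith)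
    rw [← hm] at hs
    have hproj := measure_sum_sq_projection_le b s
    refine le_trans (measure_mono fun g hg => ?_) (hproj.trans (ENNReal.ofReal_le_ofReal ?_))
    · rw [Set.mem_ofPred_eq]
      by_contra! hlt
      obtain ⟨a, ha1, ha2⟩ := hex g
      set q := ∑ j ∈ s, ((b j).ofLp ⬝ᵥ g) ^ 2
      have h := hg a
      have hcoord (i : Fin n) (j : ι) :
          (u i).ofLp ⬝ᵥ (Y j + (g j - (u k).ofLp ⬝ᵥ Y j) • (u k).ofLp) =
          if i = k then g j else (u i).ofLp ⬝ᵥ Y j := by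
        rw [dotProduct_add, dotProduct_smul, dotProduct_eq_ite]
        split_ifs with hik
        · subst hik; simp
        · simp
      simp only [hcoord] at h
      rw [← Finset.add_sum_erase _ _ (Finset.mem_univ k)] at h
      simp only [if_true] at h
      rw [hquad, ← Finset.add_sum_erase _ _ (Finset.mem_univ k), hwk, zero_mul, zero_add] at ha2
      have h5 : -∑ i ∈ Finset.univ.erase k, w i * (∑ j, a j * ((u i).ofLp ⬝ᵥ Y j)) ^ 2 ≤
          ∑ i ∈ Finset.univ.erase k,
            f i * (∑ j, a j * if i = k then g j else (u i).ofLp ⬝ᵥ Y j) ^ 2 := by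
        rw [← Finset.sum_neg_distrib]
        refine Finset.sum_le_sum fun i hi => ?_
        have hik := Finset.ne_of_mem_erase hi
        simp only [if_neg hik]
        have := hfw i hik
        nlinarith [sq_nonneg (∑ j, a j * ((u i).ofLp ⬝ᵥ Y j))]
      have h6 : ∑ j, a j * g j = q := ha1
      rw [h6] at h
      -- The projection satisfies `q > m / 8`, as it has at least `m / 2` dimensions. Hence the top
      -- term, at least `q ^ 2 / 2`, beats the remainder, at most `2 * θ * q = m * q / 16`.
      have h7 : 1 / 2 * q ^ 2 ≤ f k * q ^ 2 := by gcongr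
      have hq : 0 < q := by linarith
      nlinarith
    · rw [Real.exp_le_exp]; linarith
  refine (lintegral_mono hpt).trans ?_
  rw [lintegral_add_right _ measurable_const, lintegral_indicator_one hbad, lintegral_const,
    measure_univ, mul_one]
  gcongr

end Gaussian

/-! ### Bernoulli entries -/

section Bernoulli

variable (p : unitInterval)

lemma memLp_bernoulliMeasure : MemLp (fun x : ℝ => x) 2 (bernoulliMeasure (1 : ℝ) 0 p) :=
  (memLp_two_iff_integrable_sq aestronglyMeasurable_id).mpr (integrable_bernoulliMeasure _ _ _ _)

lemma integral_id_bernoulliMeasure : ∫ x, x ∂(bernoulliMeasure (1 : ℝ) 0 p) = p := by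
  rw [integral_bernoulliMeasure]; simp

lemma variance_id_bernoulliMeasure :
    Var[fun x => x; bernoulliMeasure (1 : ℝ) 0 p] = (p : ℝ) * (1 - p) := by
  rw [variance_eq_sub (memLp_bernoulliMeasure p), integral_id_bernoulliMeasure]
  simp only [Pi.pow_apply]
  rw [integral_bernoulliMeasure]
  simp only [smul_eq_mul]
  ring

lemma isEntryLaw_bernoulliMeasure (h0 : 0 < p) (h1 : p < 1) :
    IsEntryLaw (bernoulliMeasure (1 : ℝ) 0 p) p (p * (1 - p)) where
  prob := inferInstance
  integral_eq := integral_id_bernoulliMeasure p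
  variance_eq := variance_id_bernoulliMeasure p
  pos := by
    have h0' : (0 : ℝ) < p := h0
    have h1' : (p : ℝ) < 1 := h1
    nlinarith
  le_one := by
    have h0' : (0 : ℝ) ≤ p := p.2.1
    have h1' : (p : ℝ) ≤ 1 := p.2.2
    nlinarith
  subG := by
    have hae : ∀ᵐ x ∂(bernoulliMeasure (1 : ℝ) 0 p), x ∈ Set.Icc (0 : ℝ) 1 :=
      bernoulliMeasure_apply_of_notMem_of_notMem p measurableSet_Icc.compl (by simp) (by simp)
    have h := hasSubgaussianMGF_of_mem_Icc aemeasurable_id hae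
    simp only [id, integral_id_bernoulliMeasure] at h
    refine ⟨h.integrable_exp_mul, fun t => (h.mgf_le t).trans ?_⟩
    rw [Real.exp_le_exp]
    norm_num
    nlinarith [sq_nonneg t]

/-- The normalised row sums of the matrix are i.i.d. with mean `p * √d` and variance `p * (1 - p)`,
so the weight is the second moment of a linear form in them. -/
lemma bernoulliWeight_eq {n d : ℕ} (hd : 1 ≤ d)
    (u : OrthonormalBasis (Fin n) ℝ (EuclideanSpace ℝ (Fin n))) (i : Fin n) :
    bernoulliWeight d p (u i) = p * (1 - p) + d * (p : ℝ) ^ 2 * sumCoord (u i) ^ 2 := by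
  have hd' : (0 : ℝ) < d := by exact_mod_cast hd
  set X : (Fin d → ℝ) → ℝ := fun r => ∑ j, 1 / √(d : ℝ) * r j
  have hmem : MemLp X 2 (Measure.pi fun _ : Fin d => bernoulliMeasure (1 : ℝ) 0 p) :=
    memLp_sum_pi (memLp_bernoulliMeasure p) fun _ : Fin d => 1 / √(d : ℝ)
  have hmean : ∫ r, X r ∂(Measure.pi fun _ : Fin d => bernoulliMeasure (1 : ℝ) 0 p) =
      p * √(d : ℝ) := by
    refine (integral_sum_pi (memLp_bernoulliMeasure p) fun _ : Fin d => 1 / √(d : ℝ)).trans ?_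
    rw [integral_id_bernoulliMeasure, Finset.sum_const, Finset.card_univ, Fintype.card_fin,
      nsmul_eq_mul, mul_one_div, Real.div_sqrt]
  have hvar : Var[X; Measure.pi fun _ : Fin d => bernoulliMeasure (1 : ℝ) 0 p] =
      p * (1 - p) := by
    rw [variance_eq_sub hmem, hmean]
    have h2 := integral_sq_sum_pi (memLp_bernoulliMeasure p) fun _ : Fin d => 1 / √(d : ℝ)
    rw [integral_id_bernoulliMeasure, variance_id_bernoulliMeasure, Finset.sum_const,
      Finset.sum_const, Finset.card_univ, Fintype.card_fin, nsmul_eq_mul, nsmul_eq_mul,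
      mul_one_div, Real.div_sqrt, div_pow, Real.sq_sqrt hd'.le, one_pow,
      mul_one_div_cancel hd'.ne', mul_one] at h2
    rw [mul_pow, Real.sq_sqrt hd'.le]
    refine (congrArg (· - (p : ℝ) ^ 2 * d) h2).trans ?_
    ring
  have hform (S : Fin n → Fin d → ℝ) :
      ((Matrix.of S)ᵀ *ᵥ (u i).ofLp) ⬝ᵥ (fun _ : Fin d => 1 / √(d : ℝ)) =
        ∑ k, (u i).ofLp k * X (S k) := by
    simp only [X, dotProduct, mulVec, transpose_apply, Matrix.of_apply, Finset.sum_mul,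
      Finset.mul_sum]
    rw [Finset.sum_comm]
    exact Finset.sum_congr rfl fun k _ => Finset.sum_congr rfl fun j _ => by ring
  unfold bernoulliWeight bernoulliMatrixLaw
  simp only [hform]
  rw [integral_sq_sum_pi hmem, hvar, hmean, sum_sq_ofLp, mul_pow, Real.sq_sqrt hd'.le, sumCoord]
  ring

end Bernoulli

/-! ### Tail bounds for uncertified columns -/

section Basis

variable {n : ℕ} {u : OrthonormalBasis (Fin n) ℝ (EuclideanSpace ℝ (Fin n))}

lemma sum_spectralForm_nonpos_of_mem_uncertified {ι : Type*} [Fintype ι] {f : Fin n → ℝ}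
    {Y : ι → Fin n → ℝ} (hY : Y ∈ uncertified ι f u) : ∑ j, spectralForm u f (Y j) ≤ 0 := by
  classical
  refine Finset.sum_nonpos fun j _ => ?_
  have h := hY (Pi.single j 1)
  simpa [Pi.single_apply, spectralForm] using h

lemma sum_sumCoord_sq : ∑ i, sumCoord (u i) ^ 2 = n := by
  have h := sum_dotProduct_mul_dotProduct u (fun _ => 1) (fun _ => 1)
  simp only [dotProduct, mul_one] at h
  simpa [sumCoord, sq] using h

end Basis

section Tail

variable {n q : ℕ} [NeZero n] {lam : Fin n → ℝ}
  {u : OrthonormalBasis (Fin n) ℝ (EuclideanSpace ℝ (Fin n))}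

lemma sum_eq_zero_add_erase (g : Fin n → ℝ) :
    ∑ i, g i = g 0 + ∑ i ∈ Finset.univ.erase 0, g i :=
  (Finset.add_sum_erase _ _ (Finset.mem_univ 0)).symm

lemma abs_shiftedWeight_le {τ : ℝ} (hτ : 0 ≤ τ) (i : Fin n) :
    |shiftedWeight lam q τ i| ≤
      |lam i / lam 0| ^ (2 * q + 1) + τ * (lam i / lam 0) ^ (2 * q) := by
  have h : 0 ≤ (lam i / lam 0) ^ (2 * q) := (even_two_mul q).pow_nonneg _
  refine (abs_sub _ _).trans (le_of_eq ?_)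
  rw [abs_pow, abs_of_nonneg (mul_nonneg hτ h)]

lemma IsEntryLaw.measure_uncertified_le {ν : Measure ℝ} {m v : ℝ} (hν : IsEntryLaw ν m v)
    {ι : Type*} [Fintype ι] (h0 : 0 < lam 0) {κ τ : ℝ} (hκ : 0 < κ) (hκ1 : κ ≤ 1) (hτ : 0 ≤ τ)
    (hass : κ * ∑ i ∈ Finset.univ.erase 0,
        |lam i / lam 0| ^ (2 * q + 1) * secondMoment m v (u i) ≤
      ∑ i ∈ Finset.univ.erase 0, (lam i / lam 0) ^ (2 * q + 1) * secondMoment m v (u i))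
    (hD : τ * ∑ i, (lam i / lam 0) ^ (2 * q) * secondMoment m v (u i) ≤
      κ / 4 * ∑ i, |lam i / lam 0| ^ (2 * q + 1) * secondMoment m v (u i)) :
    Measure.pi (fun _ : ι => Measure.pi fun _ : Fin n => ν)
        (uncertified ι (shiftedWeight lam q τ) u) ≤
      ENNReal.ofReal (Real.exp (-(Fintype.card ι * (v ^ 2 * κ ^ 2 / 65536)))) := by
  have hξ := fun i => hν.secondMoment_pos (u i)
  set X := ∑ i, |lam i / lam 0| ^ (2 * q + 1) * secondMoment m v (u i) with hX
  have h00 : lam 0 / lam 0 = 1 := div_self h0.ne'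
  have hX0 : 0 < X := by
    rw [hX, sum_eq_zero_add_erase, h00]
    have : 0 ≤ ∑ i ∈ Finset.univ.erase (0 : Fin n),
      |lam i / lam 0| ^ (2 * q + 1) * secondMoment m v (u i) :=
      Finset.sum_nonneg fun i _ => mul_nonneg (by positivity) (hξ i).le
    have := hξ 0
    simp only [abs_one, one_pow, one_mul]
    linarith
  -- The absolute weights sum to at most `X + κ * X / 4 ≤ 2 * X`, and the mean is at least `κ * X -
  -- κ * X / 4`, which exceeds `(κ / 4) * (2 * X)`.
  have hbound := hν.measure_sum_spectralForm_nonpos_le (u := u) (ι := ι)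
    (f := shiftedWeight lam q τ) (fun i => abs_shiftedWeight_le hτ i)
    (W := 2 * X) (η := κ / 4) (by positivity) ?_ (by positivity) (by linarith) ?_
  · refine (measure_mono fun Y hY => sum_spectralForm_nonpos_of_mem_uncertified hY).trans
      (hbound.trans (le_of_eq ?_))
    congr 2; ring
  · simp only [add_mul, mul_assoc]
    rw [Finset.sum_add_distrib, ← Finset.mul_sum]
    nlinarith
  · simp only [shiftedWeight, sub_mul, mul_assoc]
    rw [Finset.sum_sub_distrib, ← Finset.mul_sum, sum_eq_zero_add_erase fun i =>
      (lam i / lam 0) ^ (2 * q + 1) * secondMoment m v (u i), h00, one_pow, one_mul]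
    rw [sum_eq_zero_add_erase, h00] at hX
    simp only [abs_one, one_pow, one_mul] at hX
    have := hξ 0
    nlinarith

/-- Dichotomy on the size of `P` against the number of columns. If `P` is small, the top direction
alone certifies. Otherwise the number of columns is at most `2048 * P`, so the budget `card + P` is
comparable to `P` and the averaging argument applies. -/
lemma measure_uncertified_gaussian_le_exp {ι : Type*} [Fintype ι] (h0 : 0 < lam 0)
    (hι : 16 ≤ Fintype.card ι) {κ τ : ℝ} (hκ : 0 < κ) (hκ1 : κ ≤ 1) (hτ : 0 ≤ τ)
    (hτ1 : τ ≤ 1 / 2) (hass : SpectralAssumption (fun i => lam i / lam 0) q κ)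
    (hD : τ * ∑ i, (lam i / lam 0) ^ (2 * q) ≤ κ / 16384 *
      (Fintype.card ι + ∑ i ∈ Finset.univ.erase 0, |lam i / lam 0| ^ (2 * q + 1))) :
    Measure.pi (fun _ : ι => Measure.pi fun _ : Fin n => gaussianReal 0 1)
        (uncertified ι (shiftedWeight lam q τ) u) ≤
      ENNReal.ofReal (Real.exp (-(Fintype.card ι * (κ ^ 2 / 65536)))) := by
  set P := ∑ i ∈ Finset.univ.erase 0, |lam i / lam 0| ^ (2 * q + 1) with hP
  have hP0 : 0 ≤ P := Finset.sum_nonneg fun i _ => by positivity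
  have hι' : (16 : ℝ) ≤ ((Fintype.card ι : ℕ) : ℝ) := by exact_mod_cast hι
  have h00 : lam 0 / lam 0 = 1 := div_self h0.ne'
  have heven (i : Fin n) : 0 ≤ (lam i / lam 0) ^ (2 * q) := (even_two_mul q).pow_nonneg _
  rcases le_or_gt P (((Fintype.card ι : ℕ) : ℝ) / 2048) with hcase | hcase
  · have hbound := measure_uncertified_gaussian_le (ι := ι) u 0 (f := shiftedWeight lam q τ)
      (w := fun i => if i = 0 then 0 else
        |lam i / lam 0| ^ (2 * q + 1) + τ * (lam i / lam 0) ^ (2 * q)) (fun i => ?_) (if_pos rfl)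
      (fun i hi => ?_) ?_ (by omega) ?_
    · refine hbound.trans ?_
      rw [← ENNReal.ofReal_add (Real.exp_pos _).le (Real.exp_pos _).le]
      refine ENNReal.ofReal_le_ofReal ?_
      have e1 : Real.exp (-((Fintype.card ι : ℕ) : ℝ)) ≤
          Real.exp (-(((Fintype.card ι : ℕ) : ℝ) / 8)) := by
        rw [Real.exp_le_exp]; linarith
      have e2 : Real.exp (-(((Fintype.card ι : ℕ) : ℝ) / 8)) ≤
          Real.exp (-(((Fintype.card ι : ℕ) : ℝ) / 16)) * Real.exp (-1) := by
        rw [← Real.exp_add, Real.exp_le_exp]; linarith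
      have e3 : Real.exp (-1) ≤ 1 / 2 := by
        rw [Real.exp_neg, ← one_div]
        exact one_div_le_one_div_of_le two_pos (by linarith [Real.add_one_le_exp (1 : ℝ)])
      have e4 : Real.exp (-(((Fintype.card ι : ℕ) : ℝ) / 16)) ≤
          Real.exp (-(Fintype.card ι * (κ ^ 2 / 65536))) := by
        rw [Real.exp_le_exp]
        have : κ ^ 2 ≤ 1 := pow_le_one₀ hκ.le hκ1
        nlinarith
      have e5 := Real.exp_pos (-(((Fintype.card ι : ℕ) : ℝ) / 16))
      nlinarith
    · have := heven i
      split_ifs <;> positivity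
    · rw [if_neg hi]
      exact neg_le_of_abs_le (abs_shiftedWeight_le hτ i)
    · rw [shiftedWeight, h00, one_pow, one_pow]; linarith
    · rw [sum_eq_zero_add_erase]
      simp only [if_true, zero_add]
      rw [Finset.sum_congr rfl fun i hi => if_neg (Finset.ne_of_mem_erase hi),
        Finset.sum_add_distrib, ← hP, ← Finset.mul_sum]
      have h1 : ∑ i ∈ Finset.univ.erase 0, (lam i / lam 0) ^ (2 * q) ≤
          ∑ i, (lam i / lam 0) ^ (2 * q) :=
        Finset.sum_le_sum_of_subset_of_nonneg (Finset.erase_subset _ _) fun i _ _ => heven i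
      have h2 := mul_le_mul_of_nonneg_left h1 hτ
      have h3 : κ / 16384 * (Fintype.card ι + P) ≤ 1 / 16384 * (Fintype.card ι + P) := by
        gcongr
      linarith
  · have hbound := isEntryLaw_gaussianReal.measure_uncertified_le (u := u) (ι := ι) (q := q) h0
      hκ hκ1 hτ ?_ ?_
    · simpa using hbound
    · simpa [secondMoment, SpectralAssumption] using hass
    · simp only [secondMoment, ne_eq, OfNat.ofNat_ne_zero, not_false_eq_true, zero_pow, zero_mul,
        add_zero, mul_one]
      rw [sum_eq_zero_add_erase fun i => |lam i / lam 0| ^ (2 * q + 1), ← hP, h00]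
      simp only [abs_one, one_pow]
      refine hD.trans ?_
      have : ((Fintype.card ι : ℕ) : ℝ) + P ≤ 2049 * P := by linarith
      nlinarith

/-- The threshold is `θ = p * (s / n) ^ (1 / (2q+1))` with `s = sumCoord (u 0) ^ 2`. The second
moments sum to `n * p`, because the squared coordinate sums of the basis add up to `n`, while the
top term alone contributes at least `p ^ 2 * s`; so the part below the threshold is also bounded by
`X`. -/
lemma mul_sum_secondMoment_le {p κ τ : ℝ} (hp : 0 < p) (hp1 : p ≤ 1) (h0 : 0 < lam 0)
    (hκ : 0 < κ) (hs : 0 < sumCoord (u 0) ^ 2)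
    (hτ : τ = p / 4 * (κ / 2 * (sumCoord (u 0) ^ 2 / n) ^ (1 / (2 * (q : ℝ) + 1)))) :
    τ * ∑ i, (lam i / lam 0) ^ (2 * q) * secondMoment p (p * (1 - p)) (u i) ≤
      κ / 4 * ∑ i, |lam i / lam 0| ^ (2 * q + 1) * secondMoment p (p * (1 - p)) (u i) := by
  have hn : (0 : ℝ) < n := by exact_mod_cast Nat.pos_of_neZero n
  have hξ (i : Fin n) : 0 ≤ secondMoment p (p * (1 - p)) (u i) := by
    have : 0 ≤ 1 - p := by linarith
    unfold secondMoment; positivity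
  have h00 : lam 0 / lam 0 = 1 := div_self h0.ne'
  set X := ∑ i, |lam i / lam 0| ^ (2 * q + 1) * secondMoment p (p * (1 - p)) (u i) with hX
  set r := (sumCoord (u 0) ^ 2 / n) ^ (1 / (2 * (q : ℝ) + 1)) with hr
  have hr0 : 0 < r := Real.rpow_pos_of_pos (by positivity) _
  have hrp : r ^ (2 * q + 1) = sumCoord (u 0) ^ 2 / n := rpow_root_pow (by positivity) q
  set θ := p * r with hθ
  have hθ0 : 0 < θ := by positivity
  have hpt (i : Fin n) : (lam i / lam 0) ^ (2 * q) * secondMoment p (p * (1 - p)) (u i) ≤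
      θ ^ (2 * q) * secondMoment p (p * (1 - p)) (u i) +
        |lam i / lam 0| ^ (2 * q + 1) * secondMoment p (p * (1 - p)) (u i) / θ := by
    have h := pow_le_pow_add_pow_div (abs_nonneg (lam i / lam 0)) hθ0 (2 * q)
    rw [(even_two_mul q).pow_abs] at h
    have h' := mul_le_mul_of_nonneg_right h (hξ i)
    rw [add_mul, div_mul_eq_mul_div] at h'
    exact h'
  have hsum : ∑ i, secondMoment p (p * (1 - p)) (u i) = n * p := by
    simp only [secondMoment]
    rw [Finset.sum_add_distrib, Finset.sum_const, ← Finset.mul_sum, sum_sumCoord_sq,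
      Finset.card_univ, Fintype.card_fin, nsmul_eq_mul]
    ring
  have h1 := Finset.sum_le_sum fun i (_ : i ∈ Finset.univ) => hpt i
  rw [Finset.sum_add_distrib, ← Finset.mul_sum, ← Finset.sum_div, ← hX, hsum] at h1
  have hXs : p ^ 2 * sumCoord (u 0) ^ 2 ≤ X := by
    have h2 : |lam 0 / lam 0| ^ (2 * q + 1) * secondMoment p (p * (1 - p)) (u 0) ≤ X :=
      Finset.single_le_sum (f := fun i =>
        |lam i / lam 0| ^ (2 * q + 1) * secondMoment p (p * (1 - p)) (u i))
        (fun i _ => mul_nonneg (by positivity) (hξ i)) (Finset.mem_univ 0)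
    rw [h00, abs_one, one_pow, one_mul, secondMoment] at h2
    nlinarith
  have hθX : θ ^ (2 * q + 1) * (n * p) ≤ X := by
    refine le_trans ?_ hXs
    rw [hθ, mul_pow, hrp]
    have h3 : p ^ (2 * q + 1) ≤ p := pow_le_of_le_one hp.le hp1 (by omega)
    calc p ^ (2 * q + 1) * (sumCoord (u 0) ^ 2 / n) * (n * p)
        = p ^ (2 * q + 1) * (p * sumCoord (u 0) ^ 2) := by field_simp
      _ ≤ p * (p * sumCoord (u 0) ^ 2) := by gcongr
      _ = _ := by ring
  have hτθ : τ = κ * θ / 8 := by rw [hτ, hθ]; ring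
  rw [hτθ]
  calc κ * θ / 8 * ∑ i, (lam i / lam 0) ^ (2 * q) * secondMoment p (p * (1 - p)) (u i)
      ≤ κ * θ / 8 * (θ ^ (2 * q) * (n * p) + X / θ) := by gcongr
    _ = κ / 8 * (θ ^ (2 * q + 1) * (n * p) + X) := by field_simp; ring
    _ ≤ κ / 8 * (X + X) := by gcongr
    _ = κ / 4 * X := by ring

lemma SpectralAssumption.div (h0 : 0 < lam 0) {κ : ℝ} (h : SpectralAssumption lam q κ) :
    SpectralAssumption (fun i => lam i / lam 0) q κ := by
  unfold SpectralAssumption at h ⊢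
  simp only [abs_div, div_pow, abs_of_pos h0]
  rw [← Finset.sum_div, ← Finset.sum_div, mul_div_assoc']
  gcongr

/-- The two spectral assumptions together imply the second one with the weights of a single
Bernoulli column. -/
lemma secondMoment_assumption {d : ℕ} (hd : 1 ≤ d) (h0 : 0 < lam 0) {p : unitInterval}
    {κ κ' ν : ℝ} (h1 : SpectralAssumption lam q κ)
    (h2 : WeightedSpectralAssumption lam u q d p ν κ') :
    min κ κ' * ∑ i ∈ Finset.univ.erase 0,
        |lam i / lam 0| ^ (2 * q + 1) * secondMoment p (p * (1 - p)) (u i) ≤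
      ∑ i ∈ Finset.univ.erase 0,
        (lam i / lam 0) ^ (2 * q + 1) * secondMoment p (p * (1 - p)) (u i) := by
  have hd' : (1 : ℝ) ≤ d := by exact_mod_cast hd
  have hp0 : (0 : ℝ) ≤ p := p.2.1
  have hp1 : (p : ℝ) ≤ 1 := p.2.2
  have h2' := h2.2
  unfold SpectralAssumption at h1
  set v : ℝ := p * (1 - p) with hv
  have hv0 : 0 ≤ v := mul_nonneg hp0 (by linarith)
  have hw (i : Fin n) : 0 ≤ bernoulliWeight d p (u i) := by
    rw [bernoulliWeight_eq p hd]; positivity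
  -- The single-column weight is a convex combination of the `d`-column weight and the constant `v`;
  -- the second assumption handles the former, the first assumption the latter.
  have hξ (i : Fin n) : secondMoment p v (u i) =
      1 / d * bernoulliWeight d p (u i) + (1 - 1 / d) * v := by
    rw [bernoulliWeight_eq p hd, secondMoment]
    field_simp
    ring
  have hd1 : (0 : ℝ) ≤ 1 - 1 / d := by
    rw [sub_nonneg, div_le_one (by linarith)]; exact hd'
  have hsplit (g : Fin n → ℝ) : ∑ i ∈ Finset.univ.erase 0, g i * secondMoment p v (u i) =
      1 / d * ∑ i ∈ Finset.univ.erase 0, g i * bernoulliWeight d p (u i) +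
        (1 - 1 / d) * v * ∑ i ∈ Finset.univ.erase 0, g i := by
    rw [Finset.mul_sum, Finset.mul_sum, ← Finset.sum_add_distrib]
    exact Finset.sum_congr rfl fun i _ => by rw [hξ]; ring
  have hmain : min κ κ' * ∑ i ∈ Finset.univ.erase 0, |lam i| ^ (2 * q + 1) *
      secondMoment p v (u i) ≤
      ∑ i ∈ Finset.univ.erase 0, lam i ^ (2 * q + 1) * secondMoment p v (u i) := by
    rw [hsplit, hsplit]
    have a1 : min κ κ' * ∑ i ∈ Finset.univ.erase 0, |lam i| ^ (2 * q + 1) ≤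
        ∑ i ∈ Finset.univ.erase 0, lam i ^ (2 * q + 1) :=
      (mul_le_mul_of_nonneg_right (min_le_left _ _)
        (Finset.sum_nonneg fun i _ => by positivity)).trans h1
    have a2 : min κ κ' * ∑ i ∈ Finset.univ.erase 0,
        |lam i| ^ (2 * q + 1) * bernoulliWeight d p (u i) ≤
        ∑ i ∈ Finset.univ.erase 0, lam i ^ (2 * q + 1) * bernoulliWeight d p (u i) :=
      (mul_le_mul_of_nonneg_right (min_le_right _ _)
        (Finset.sum_nonneg fun i _ => mul_nonneg (by positivity) (hw i))).trans h2'
    have b1 := mul_le_mul_of_nonneg_left a1 (mul_nonneg hd1 hv0)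
    have b2 := mul_le_mul_of_nonneg_left a2 (by positivity : (0 : ℝ) ≤ 1 / d)
    linarith
  simp only [abs_div, div_pow, abs_of_pos h0, div_mul_eq_mul_div]
  rw [← Finset.sum_div, ← Finset.sum_div, mul_div_assoc']
  gcongr

end Tail

/-! ### The test matrix of RandSum -/

section Law

variable {n d : ℕ} {p : unitInterval}

/-- The law of the entries in column `j` of the test matrix. -/
def columnLaw (d : ℕ) (p : unitInterval) (j : Fin d) : Measure ℝ :=
  if (j : ℕ) < (d + 1) / 2 then gaussianReal 0 1 else bernoulliMeasure (1 : ℝ) 0 p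

instance (j : Fin d) : IsProbabilityMeasure (columnLaw d p j) := by
  unfold columnLaw; split_ifs <;> infer_instance

lemma randSumLaw_restrict (P : Fin d → Prop) [DecidablePred P] {ν : Measure ℝ}
    (hν : ∀ j, P j → columnLaw d p j = ν) {T : Set ({j // P j} → Fin n → ℝ)}
    (hT : MeasurableSet T) :
    randSumLaw n d p {S | (fun j : {j // P j} => Function.swap S j) ∈ T} =
      Measure.pi (fun _ : {j // P j} => Measure.pi fun _ : Fin n => ν) T := by
  have hmp := (measurePreserving_subtype_restrict
    (fun j : Fin d => Measure.pi fun _ : Fin n => columnLaw d p j) P).comp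
    (measurePreserving_swap_pi (n := n) (columnLaw d p))
  have h := hmp.measure_preimage hT.nullMeasurableSet
  have hlaw : (fun j : {j // P j} => Measure.pi fun _ : Fin n => columnLaw d p j) =
      fun _ => Measure.pi fun _ => ν := funext fun j => by rw [hν j j.2]
  rw [hlaw] at h
  exact h

lemma card_gaussian_columns : Fintype.card {j : Fin d // (j : ℕ) < (d + 1) / 2} = (d + 1) / 2 := by
  rw [Fintype.card_subtype, Fin.card_filter_val_lt]
  omega

lemma card_bernoulli_columns : Fintype.card {j : Fin d // ¬ (j : ℕ) < (d + 1) / 2} = d / 2 := by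
  rw [Fintype.card_subtype_compl, card_gaussian_columns, Fintype.card_fin]
  omega

end Law

/-! ### The two lower bounds for the output -/

section Bounds

variable {n q d : ℕ} [NeZero n] {A : Matrix (Fin n) (Fin n) ℝ} {lam : Fin n → ℝ}
  {u : OrthonormalBasis (Fin n) ℝ (EuclideanSpace ℝ (Fin n))} {p : unitInterval}

lemma randSumLaw_powerLaw_le (hA : A.IsSymm) (hu : IsSortedEigensystem A lam u)
    (h0 : 0 < lam 0) (hq : 1 ≤ q) (hd : 32 ≤ d) (C : ℝ) {κ : ℝ} (hκ : 0 < κ) (hκ1 : κ ≤ 1)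
    (hass : SpectralAssumption lam q κ) :
    randSumLaw n d p {S | ∃ v, IsRSVDOutput A (Matrix.of S) q v ∧
        rayleigh A (lam 0) v < 1 / (393216 * max C 1) *
          (κ * ((d : ℝ) / (d + powerLawIndex A q C)) ^ (1 / (2 * (q : ℝ) + 1)))} ≤
      ENNReal.ofReal (Real.exp (-(d * (κ ^ 2 / 131072)))) := by
  have hC : 1 ≤ max C 1 := le_max_right _ _
  have hd' : (32 : ℝ) ≤ d := by exact_mod_cast hd
  set r := ((d : ℝ) / (d + powerLawIndex A q C)) ^ (1 / (2 * (q : ℝ) + 1)) with hr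
  have hx0 : 0 ≤ (d : ℝ) / (d + powerLawIndex A q C) := by positivity
  have hr0 : 0 ≤ r := Real.rpow_nonneg hx0 _
  have hr1 : r ≤ 1 := by
    refine Real.rpow_le_one hx0 ?_ (by positivity)
    rw [div_le_one (by positivity)]
    linarith [(Nat.cast_nonneg (powerLawIndex A q C) : (0 : ℝ) ≤ _)]
  set τ := 1 / (393216 * max C 1) * (κ * r) with hτ
  have hκr : κ * r ≤ 1 := mul_le_one₀ hκ1 hr0 hr1
  have hτ0 : 0 ≤ τ := by positivity
  have hτ1 : τ ≤ 1 / 2 := by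
    have h1 : 1 / (393216 * max C 1) ≤ 1 / 2 :=
      one_div_le_one_div_of_le (by norm_num) (by linarith)
    calc τ ≤ 1 / 2 * 1 := by rw [hτ]; gcongr
      _ = 1 / 2 := mul_one _
  have hcard := card_gaussian_columns (d := d)
  have hm : (d : ℝ) / 2 ≤ ((Fintype.card {j : Fin d // (j : ℕ) < (d + 1) / 2} : ℕ) : ℝ) := by
    rw [hcard, div_le_iff₀ two_pos]
    have : d ≤ (d + 1) / 2 * 2 := by omega
    exact_mod_cast this
  set m : ℝ := ((Fintype.card {j : Fin d // (j : ℕ) < (d + 1) / 2} : ℕ) : ℝ) with hmdef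
  set P := ∑ i ∈ Finset.univ.erase 0, |lam i / lam 0| ^ (2 * q + 1) with hP
  have hP0 : 0 ≤ P := Finset.sum_nonneg fun i _ => by positivity
  -- The constant in `τ` is `393216 = 24 * 16384`, from the power-sum comparison with `β = κ /
  -- 16384`.
  have hD : τ * ∑ i, (lam i / lam 0) ^ (2 * q) ≤ κ / 16384 * (m + P) := by
    have h := mul_sum_pow_le_of_powerLawIndex hA hu h0 hq (by omega : 1 ≤ d) C
      (β := κ / 16384) (X := m + P) (by positivity) (by linarith) (by
        rw [sum_eq_zero_add_erase, div_self h0.ne', ← hP, abs_one, one_pow]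
        linarith)
    refine le_trans (le_of_eq ?_) h
    rw [hτ, ← hr]
    congr 1
    field_simp
    ring
  have hmain := measure_uncertified_gaussian_le_exp (u := u)
    (ι := {j : Fin d // (j : ℕ) < (d + 1) / 2}) h0 (by rw [hcard]; omega) hκ hκ1 hτ0 hτ1
    (hass.div h0) hD
  rw [← randSumLaw_restrict (p := p) _ (fun j hj => if_pos hj)
    (isClosed_uncertified _ _ _).measurableSet] at hmain
  refine (measure_mono ?_).trans (hmain.trans (ENNReal.ofReal_le_ofReal ?_))
  · rintro S ⟨v, hv, hlt⟩
    exact restrict_mem_uncertified (hv.mem_uncertified hA hu h0 hlt) _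
  · rw [Real.exp_le_exp, neg_le_neg_iff, ← hmdef]
    have : 0 ≤ κ ^ 2 := by positivity
    nlinarith

lemma randSumLaw_sumCoord_le (hA : A.IsSymm) (hu : IsSortedEigensystem A lam u)
    (h0 : 0 < lam 0) (hd : 2 ≤ d) (hp0 : 0 < p) (hp1 : p < 1) {κ κ' ν : ℝ} (hκ : 0 < κ)
    (hκ1 : κ ≤ 1) (hκ' : 0 < κ') (hass : SpectralAssumption lam q κ)
    (hass' : WeightedSpectralAssumption lam u q d p ν κ') (hs : 0 < sumCoord (u 0) ^ 2) :
    randSumLaw n d p {S | ∃ v, IsRSVDOutput A (Matrix.of S) q v ∧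
        rayleigh A (lam 0) v < p / 4 * (min κ κ' / 2 *
          (sumCoord (u 0) ^ 2 / n) ^ (1 / (2 * (q : ℝ) + 1)))} ≤
      ENNReal.ofReal (Real.exp
        (-(d * (((p : ℝ) * (1 - p)) ^ 2 * min κ κ' ^ 2 / 196608)))) := by
  have hp0' : (0 : ℝ) < p := hp0
  have hp1' : (p : ℝ) ≤ 1 := p.2.2
  have hk : 0 < min κ κ' := lt_min hκ hκ'
  have hk1 : min κ κ' ≤ 1 := (min_le_left _ _).trans hκ1
  set τ := p / 4 * (min κ κ' / 2 * (sumCoord (u 0) ^ 2 / n) ^ (1 / (2 * (q : ℝ) + 1))) with hτ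
  have hτ0 : 0 ≤ τ := by positivity
  have hcard := card_bernoulli_columns (d := d)
  have hmain := (isEntryLaw_bernoulliMeasure p hp0 hp1).measure_uncertified_le (u := u) (q := q)
    (ι := {j : Fin d // ¬ (j : ℕ) < (d + 1) / 2}) h0 hk hk1 hτ0
    (secondMoment_assumption (by omega) h0 hass hass')
    (mul_sum_secondMoment_le hp0' hp1' h0 hk hs hτ)
  rw [← randSumLaw_restrict (d := d) (p := p) _ (fun j hj => if_neg hj)
    (isClosed_uncertified _ _ _).measurableSet] at hmain
  refine (measure_mono ?_).trans (hmain.trans (ENNReal.ofReal_le_ofReal ?_))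
  · rintro S ⟨v, hv, hlt⟩
    exact restrict_mem_uncertified (hv.mem_uncertified hA hu h0 hlt) _
  · rw [Real.exp_le_exp, neg_le_neg_iff, hcard]
    -- For `d ≥ 2` at least a third of the columns are Bernoulli, whence `196608 = 3 * 65536`.
    have h3 : (d : ℝ) / 3 ≤ ((d / 2 : ℕ) : ℝ) := by
      rw [div_le_iff₀ (by norm_num)]
      have : d ≤ d / 2 * 3 := by omega
      exact_mod_cast this
    have : 0 ≤ ((p : ℝ) * (1 - p)) ^ 2 * min κ κ' ^ 2 := by positivity
    nlinarith

/-- Both `d` and `i₀` are at most `n`, so `d + i₀ ≤ 2 * n`, and the exponent is at most `1`. Thus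
when `d` realises the inner maximum, the second bound follows from the first. -/
lemma div_rpow_le_two_mul (hdn : d ≤ n) (hd : 1 ≤ d) (C : ℝ) :
    ((d : ℝ) / n) ^ (1 / (2 * (q : ℝ) + 1)) ≤
      2 * ((d : ℝ) / (d + powerLawIndex A q C)) ^ (1 / (2 * (q : ℝ) + 1)) := by
  have hn : (0 : ℝ) < n := by exact_mod_cast Nat.pos_of_neZero n
  have hd0 : (0 : ℝ) < d := by exact_mod_cast hd
  have hi : (powerLawIndex A q C : ℝ) ≤ n := by exact_mod_cast powerLawIndex_le q C
  have hdn' : (d : ℝ) ≤ n := by exact_mod_cast hdn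
  have h1 : (d : ℝ) / n ≤ 2 * (d / (d + powerLawIndex A q C)) := by
    rw [mul_div_assoc', div_le_div_iff₀ hn (by positivity)]
    nlinarith
  refine (Real.rpow_le_rpow (by positivity) h1 (by positivity)).trans ?_
  rw [Real.mul_rpow (by norm_num) (by positivity)]
  gcongr
  refine Real.rpow_le_self_of_one_le (by norm_num) ?_
  rw [div_le_one (by positivity)]
  linarith [(Nat.cast_nonneg q : (0 : ℝ) ≤ q)]

end Bounds

end RandSum

end

/-! ### Assembly of the two bounds. -/

theorem mainTheorem6 :
    ∃ c₁ : ℝ → ℝ, (∀ κ ∈ Set.Ioc (0 : ℝ) 1, c₁ κ ∈ Set.Ioc (0 : ℝ) 1) ∧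
    ∀ (p : unitInterval) (ν : ℝ), 0 < p → p < 1 → 0 < ν →
    ∃ c₂ : ℝ → ℝ → ℝ,
      (∀ κ ∈ Set.Ioc (0 : ℝ) 1, ∀ κ' ∈ Set.Ioc (0 : ℝ) 1, c₂ κ κ' ∈ Set.Ioc (0 : ℝ) 1) ∧
    ∃ b : ℝ, 0 < b ∧ ∃ x₀ : ℝ, 0 < x₀ ∧
    ∀ C : ℝ, 0 < C → ∃ c : ℝ, 0 < c ∧
    ∀ κ ∈ Set.Ioc (0 : ℝ) 1, ∀ κ' ∈ Set.Ioc (0 : ℝ) 1,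
    ∀ (n d q : ℕ) [NeZero n], 1 ≤ q → d ≤ n → x₀ ≤ √(d : ℝ) * min κ κ' ^ 2 →
    ∀ (A : Matrix (Fin n) (Fin n) ℝ) (lam : Fin n → ℝ)
      (u : OrthonormalBasis (Fin n) ℝ (EuclideanSpace ℝ (Fin n))),
      A.IsSymm → RandSum.IsSortedEigensystem A lam u → 0 < lam 0 →
      RandSum.SpectralAssumption lam q κ →
      RandSum.WeightedSpectralAssumption lam u q d p ν κ' →
      RandSum.randSumLaw n d p
        {S | ∃ v, RandSum.IsRSVDOutput A (Matrix.of S) q v ∧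
          RandSum.rayleigh A (lam 0) v <
            c * max
              (c₁ κ * ((d : ℝ) / (d + RandSum.powerLawIndex A q C)) ^ (1 / (2 * (q : ℝ) + 1)))
              (c₂ κ κ' * (max (d : ℝ) (RandSum.sumCoord (u 0) ^ 2) / n) ^
                (1 / (2 * (q : ℝ) + 1)))}
        ≤ ENNReal.ofReal (Real.exp (-(b * (√(d : ℝ) * min κ κ' ^ 2)))) := by
  -- The factor `1 / 2` in the second constant cancels the `2` of `div_rpow_le_two_mul`.
  refine ⟨id, fun κ hκ => hκ, fun p ν hp0 hp1 hν => ⟨fun κ κ' => min κ κ' / 2,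
    fun κ hκ κ' hκ' => ⟨half_pos (lt_min hκ.1 hκ'.1), by
      linarith [min_le_left κ κ', hκ.2, lt_min hκ.1 hκ'.1]⟩, ?_⟩⟩
  have hp0' : (0 : ℝ) < p := hp0
  have hp1' : (p : ℝ) < 1 := hp1
  have hv0 : 0 < (p : ℝ) * (1 - p) := mul_pos hp0' (by linarith)
  have hv1 : (p : ℝ) * (1 - p) ≤ 1 := by nlinarith
  refine ⟨((p : ℝ) * (1 - p)) ^ 2 / 196608, by positivity, 6, by norm_num, fun C _ => ?_⟩
  refine ⟨min (1 / (393216 * max C 1)) (p / 4), by positivity, ?_⟩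
  intro κ hκ κ' hκ' n d q _ hq hdn hx A lam u hA hu h0 hass hass'
  set k := min κ κ' with hk
  have hk0 : 0 < k := lt_min hκ.1 hκ'.1
  have hkκ : k ≤ κ := min_le_left _ _
  have hk1 : k ^ 2 ≤ 1 := pow_le_one₀ hk0.le (hkκ.trans hκ.2)
  have hsqrt : 6 ≤ √(d : ℝ) := hx.trans (mul_le_of_le_one_right (Real.sqrt_nonneg _) hk1)
  have hsq : √(d : ℝ) * √(d : ℝ) = d := Real.mul_self_sqrt (Nat.cast_nonneg d)
  -- The choice `x₀ = 6` ensures the `32` columns, hence `16` Gaussian ones, that the Gaussian bound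
  -- requires. The tail bounds decay in `d`, and `√d ≤ d` weakens them to the stated rate.
  have hd36 : 36 ≤ d := by
    have : (36 : ℝ) ≤ d := by nlinarith
    exact_mod_cast this
  have hsd : √(d : ℝ) ≤ d := by nlinarith
  have hv2 : ((p : ℝ) * (1 - p)) ^ 2 ≤ 1 := pow_le_one₀ hv0.le hv1
  have hC0 : 0 < 1 / (393216 * max C 1) := by positivity
  set c := min (1 / (393216 * max C 1)) ((p : ℝ) / 4)
  set r := ((d : ℝ) / (d + RandSum.powerLawIndex A q C)) ^ (1 / (2 * (q : ℝ) + 1))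
  have hr0 : 0 ≤ r := by positivity
  have hgauss : RandSum.randSumLaw n d p
      {S | ∃ v, RandSum.IsRSVDOutput A (Matrix.of S) q v ∧
        RandSum.rayleigh A (lam 0) v < 1 / (393216 * max C 1) * (κ * r)} ≤
      ENNReal.ofReal (Real.exp (-(((p : ℝ) * (1 - p)) ^ 2 / 196608 * (√(d : ℝ) * k ^ 2)))) := by
    refine (RandSum.randSumLaw_powerLaw_le hA hu h0 hq (by omega) C hκ.1 hκ.2 hass).trans
      (ENNReal.ofReal_le_ofReal ?_)
    rw [Real.exp_le_exp, neg_le_neg_iff]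
    have h1 : √(d : ℝ) * k ^ 2 ≤ d * κ ^ 2 := by gcongr
    calc ((p : ℝ) * (1 - p)) ^ 2 / 196608 * (√(d : ℝ) * k ^ 2)
        ≤ 1 / 131072 * (d * κ ^ 2) := by gcongr; norm_num
      _ = _ := by ring
  have hcr : c * (κ * r) ≤ 1 / (393216 * max C 1) * (κ * r) :=
    mul_le_mul_of_nonneg_right (min_le_left _ _) (mul_nonneg hκ.1.le hr0)
  rcases lt_or_ge (RandSum.sumCoord (u 0) ^ 2) (d : ℝ) with hs | hs
  · refine (measure_mono ?_).trans hgauss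
    rintro S ⟨v, hv, hlt⟩
    refine ⟨v, hv, hlt.trans_le (le_trans ?_ hcr)⟩
    have hc0 : 0 ≤ c := by positivity
    refine mul_le_mul_of_nonneg_left (max_le le_rfl ?_) hc0
    rw [max_eq_left hs.le]
    have hκ0 := hκ.1
    have h2 := RandSum.div_rpow_le_two_mul (q := q) (A := A) hdn (by omega) C
    calc k / 2 * ((d : ℝ) / n) ^ (1 / (2 * (q : ℝ) + 1)) ≤ κ / 2 * (2 * r) := by gcongr
      _ = id κ * r := by simp only [id]; ring
  · rw [max_eq_right hs]
    set t := (RandSum.sumCoord (u 0) ^ 2 / (n : ℝ)) ^ (1 / (2 * (q : ℝ) + 1))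
    have ht0 : 0 ≤ t := by positivity
    have hct : c * (k / 2 * t) ≤ p / 4 * (k / 2 * t) :=
      mul_le_mul_of_nonneg_right (min_le_right _ _) (by positivity)
    -- Which term of the maximum is larger does not depend on `S`, so only one of the two bad events
    -- matters and no union bound is needed.
    rcases le_total (k / 2 * t) (κ * r) with h | h
    · refine (measure_mono ?_).trans hgauss
      rintro S ⟨v, hv, hlt⟩
      change RandSum.rayleigh A (lam 0) v < c * max (κ * r) (k / 2 * t) at hlt
      rw [max_eq_left h] at hlt
      exact ⟨v, hv, hlt.trans_le hcr⟩
    · have hs0 : 0 < RandSum.sumCoord (u 0) ^ 2 := hν.trans_le hass'.1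
      refine le_trans (measure_mono ?_) ((RandSum.randSumLaw_sumCoord_le hA hu h0 (by omega) hp0
        hp1 hκ.1 hκ.2 hκ'.1 hass hass' hs0).trans (ENNReal.ofReal_le_ofReal ?_))
      · rintro S ⟨v, hv, hlt⟩
        change RandSum.rayleigh A (lam 0) v < c * max (κ * r) (k / 2 * t) at hlt
        rw [max_eq_right h] at hlt
        exact ⟨v, hv, hlt.trans_le hct⟩
      · rw [Real.exp_le_exp, neg_le_neg_iff, ← hk]
        calc ((p : ℝ) * (1 - p)) ^ 2 / 196608 * (√(d : ℝ) * k ^ 2)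
            ≤ ((p : ℝ) * (1 - p)) ^ 2 / 196608 * (d * k ^ 2) := by gcongr
          _ = _ := by ring
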